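/- For graphs, $+$ denotes disjoint union and $tH$ the disjoint union of $t$ copies of $H$; $P_k$ is the path on $k$ vertices, $\overline{K}_m$ the graph with $m$ vertices and no edges, and $\alpha'$ the matching number. A graph $G$ is $H$-saturated if $G$ contains no copy of $H$ as a (not necessarily induced) subgraph, but adding to $G$ any edge of its complement creates a copy of $H$. A fan $F_i$ consists of $i$ triangles sharing one common vertex, so it has order $2i+1$. \textbf{Theorem.} Let $t\ge 1$ be an integer and let $n$ be sufficiently large (in terms of $t$). Let $G$ be a $(P_7+tP_2)$-saturated graph on $n$ vertices with at least two isolated vertices and $|E(G)|\le 3t+25$. Then $|E(G)|=3t+25$, and there are an integer $c\ge 0$ and a (possibly empty) disjoint union $F$ of fans, each of order at least $7$, with $\alpha'(cK_3+F)=t-1$, such that $$G\cong K_8+cK_3+F+\overline{K}_{n-3c-|V(F)|-8}.$$ -/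

import Mathlib

open scoped SimpleGraph

namespace LinearForestSat

/-- The disjoint union of a family of graphs. -/
def disjointUnion {ι : Type*} {V : ι → Type*} (G : ∀ i, SimpleGraph (V i)) :
    SimpleGraph (Σ i, V i) where
  Adj x y := ∃ (i : ι) (a b : V i), (G i).Adj a b ∧ x = ⟨i, a⟩ ∧ y = ⟨i, b⟩
  symm := ⟨by
    rintro _ _ ⟨i, a, b, h, rfl, rfl⟩
    exact ⟨i, b, a, h.symm, rfl, rfl⟩⟩
  loopless := ⟨by
    rintro x ⟨i, a, b, h, h1, h2⟩
    have h3 := h1.symm.trans h2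
    simp only [Sigma.mk.injEq, heq_eq_eq, true_and] at h3
    exact h.ne h3⟩

/-- The disjoint union of `t` copies of `H`. -/
def copies {V : Type*} (t : ℕ) (H : SimpleGraph V) : SimpleGraph (Σ _ : Fin t, V) :=
  disjointUnion fun _ : Fin t => H

/-- The linear forest `P_k + t P_2`, where `P_k` is the path on `k` vertices. -/
def pathPlusMatching (k t : ℕ) : SimpleGraph (Fin k ⊕ (Σ _ : Fin t, Fin 2)) :=
  SimpleGraph.pathGraph k ⊕g copies t (SimpleGraph.pathGraph 2)

/-- `G` is `H`-saturated: it contains no copy of `H` (as a not necessarily induced subgraph), but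
adding any edge of the complement of `G` creates one. -/
def IsSaturated {V W : Type*} (H : SimpleGraph W) (G : SimpleGraph V) : Prop :=
  ¬ H ⊑ G ∧ ∀ u v : V, Gᶜ.Adj u v → H ⊑ G ⊔ SimpleGraph.edge u v

/-- The fan `F_i`: `i` triangles sharing one vertex. The shared vertex is `none`; the other two
vertices of the `j`-th triangle are `some (j, false)` and `some (j, true)`. -/
def fan (i : ℕ) : SimpleGraph (Option (Fin i × Bool)) where
  Adj
    | none, none => False
    | none, some _ => True
    | some _, none => True
    | some p, some q => p.1 = q.1 ∧ p.2 ≠ q.2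
  symm := ⟨by
    rintro (_ | p) (_ | q) h
    · exact h
    · trivial
    · trivial
    · exact ⟨h.1.symm, h.2.symm⟩⟩
  loopless := ⟨by
    rintro (_ | p) h
    · exact h
    · exact h.2 rfl⟩

/-- The disjoint union of the fans `F_{s 0}, …, F_{s (k-1)}`. -/
def fans {k : ℕ} (s : Fin k → ℕ) : SimpleGraph (Σ j : Fin k, Option (Fin (s j) × Bool)) :=
  disjointUnion fun j => fan (s j)

/-- The matching number: the largest number of edges of a matching in `G` (for finite `G`). -/
noncomputable def matchingNumber {V : Type*} (G : SimpleGraph V) : ℕ :=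
  sSup {m : ℕ | ∃ M : G.Subgraph, M.IsMatching ∧ M.edgeSet.ncard = m}

end LinearForestSat

set_option linter.unusedSectionVars false

namespace LinearForestSat

open Finset

/-! The proof compares the degree sum of G with the size of a maximum matching, one component at a
time. Matchings are involutions, so twice the number of matching edges is the number of moved
vertices.

Joining two isolated vertices creates a copy of P_7 + tP_2 whose path avoids the new edge. Hence G
contains P_7 + (t-1)P_2 and has matching number at least t+2. If it were exactly t+2, every vertex
would be missed by some maximum matching. A Gallai-type argument then makes every component an odd
clique, and the edge bound leaves room for just one component containing a P_7, a K_7. Joining an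
isolated vertex to it produces no copy, a contradiction (`IsCopySat.card_moved_ne`).

So the matching number is at least t+3. Then no P_7 has a vertex set invariant under a maximum
matching (`NoCheap`), since such a path spoils only three matching edges. Together with minimum
degree two on nonisolated vertices, this makes the set of missable vertices closed under adjacency
(`IsCopySat.missable_of_adj`), and each missable vertex lies in a set of five vertices that
saturation makes a K_5, or in a fan, possibly trivial (`NoCheap.five_or_fan`). A component
containing a P_7 is therefore perfectly matched by every maximum matching, and it has a P_7 meeting
at most four matching edges (`hasFrugalPath`). This bounds the matching number by t+3. Saturation
then makes every component without missable vertices a clique of even order at least six.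

Give a component the weight "degree sum minus three times the number of covered vertices". Isolated
vertices and fans have weight at least 0, K_5 at least 8, and a covered K_s has s(s-4). The total is
at most 6t+50-3(2t+6)=32, the weight of K_8. The component containing a P_7 has even order at least
eight, so it is K_8, equality holds, and only fans, triangles and isolated vertices remain
(`Setup.structure`). -/

/-- An involution encoding a matching of `G`: the moved vertices are matched to their images. -/
structure IsMatch {V : Type*} (G : SimpleGraph V) (f : V → V) : Prop where
  invol : ∀ v, f (f v) = v
  adj : ∀ v, f v ≠ v → G.Adj v (f v)

/-- The vertices covered by the matching encoded by `f`. -/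
def moved {V : Type*} [Fintype V] [DecidableEq V] (f : V → V) : Finset V :=
  univ.filter fun v => f v ≠ v

/-- A list of seven vertices forming a path. -/
structure IsPath7 {V : Type*} (G : SimpleGraph V) (l : List V) : Prop where
  len : l.length = 7
  nodup : l.Nodup
  chain : l.IsChain G.Adj

/-- `G` contains a path on seven vertices and a disjoint matching of `t` edges. -/
def HasCopy {V : Type*} [Fintype V] [DecidableEq V] (G : SimpleGraph V) (t : ℕ) : Prop :=
  ∃ (l : List V) (f : V → V), IsPath7 G l ∧ IsMatch G f ∧ (∀ v ∈ l, f v = v) ∧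
    2 * t ≤ (moved f).card

/-- A matching covering the most vertices. -/
def IsMaxMatch {V : Type*} [Fintype V] [DecidableEq V] (G : SimpleGraph V) (f : V → V) : Prop :=
  IsMatch G f ∧ ∀ g, IsMatch G g → (moved g).card ≤ (moved f).card

/-- No edge leaves `S`. -/
def IsClosedSet {V : Type*} (G : SimpleGraph V) (S : Finset V) : Prop :=
  ∀ v ∈ S, ∀ w, G.Adj v w → w ∈ S

/-! ### Matchings as involutions, exchanges and augmentations -/

section
variable {V : Type*} {G : SimpleGraph V} {f g : V → V}

lemma IsMatch.inj (hf : IsMatch G f) {a b : V} (h : f a = f b) : a = b := by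
  rw [← hf.invol a, h, hf.invol]

lemma IsMatch.eq_comm (hf : IsMatch G f) {a b : V} (h : f a = b) : f b = a := by
  rw [← h, hf.invol]

lemma IsMatch.ne (hf : IsMatch G f) {a : V} (h : f a ≠ a) : f (f a) ≠ f a := by
  rw [hf.invol]; exact h.symm

lemma isMatch_id : IsMatch G id := ⟨fun _ => rfl, fun _ h => absurd rfl h⟩

variable [DecidableEq V]

lemma IsMatch.even_filter (hf : IsMatch G f) {S : Finset V} (hS : ∀ v ∈ S, f v ∈ S) :
    Even (S.filter fun v => f v ≠ v).card := by
  have h : ∑ v ∈ S.filter (fun v => f v ≠ v), (1 : ZMod 2) = 0 := by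
    refine Finset.sum_involution (fun v _ => f v) ?_ ?_ ?_ ?_
    · intros; decide
    · intro v hv _; exact (mem_filter.1 hv).2
    · intro v hv
      have := mem_filter.1 hv
      exact mem_filter.2 ⟨hS v this.1, hf.ne this.2⟩
    · intro v _; exact hf.invol v
  rw [Finset.sum_const, nsmul_eq_mul, mul_one] at h
  exact (ZMod.natCast_eq_zero_iff_even).1 h

/-- Replace `f` by `g` on an invariant set. -/
lemma IsMatch.piecewise (hf : IsMatch G f) (hg : IsMatch G g) (S : Finset V)
    (hfS : ∀ v ∈ S, f v ∈ S) (hgS : ∀ v ∈ S, g v ∈ S) :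
    IsMatch G (fun v => if v ∈ S then g v else f v) := by
  have hfS' : ∀ v ∉ S, f v ∉ S := fun v hv h => hv (by simpa [hf.invol] using hfS _ h)
  constructor
  · intro v
    by_cases hv : v ∈ S
    · simp [hv, hgS v hv, hg.invol]
    · simp [hv, hfS' v hv, hf.invol]
  · intro v
    by_cases hv : v ∈ S
    · simpa [hv] using hg.adj v
    · simpa [hv] using hf.adj v

variable [Fintype V]

@[simp] lemma mem_moved {v : V} : v ∈ moved f ↔ f v ≠ v := by simp [moved]

lemma IsMatch.even_moved (hf : IsMatch G f) : Even (moved f).card :=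
  hf.even_filter (fun _ _ => mem_univ _)

lemma card_moved_piecewise (S : Finset V) :
    (moved fun v => if v ∈ S then g v else f v).card + (S.filter fun v => f v ≠ v).card =
      (moved f).card + (S.filter fun v => g v ≠ v).card := by
  have h1 : (moved fun v => if v ∈ S then g v else f v) =
      (S.filter fun v => g v ≠ v) ∪ (Sᶜ.filter fun v => f v ≠ v) := by
    ext v; by_cases hv : v ∈ S <;> simp [hv]
  have h2 : moved f = (S.filter fun v => f v ≠ v) ∪ (Sᶜ.filter fun v => f v ≠ v) := by
    ext v; by_cases hv : v ∈ S <;> simp [hv]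
  rw [h1, h2, card_union_of_disjoint, card_union_of_disjoint]
  · omega
  · exact disjoint_filter_filter (disjoint_compl_right)
  · exact disjoint_filter_filter (disjoint_compl_right)

lemma exists_isMaxMatch (G : SimpleGraph V) : ∃ f, IsMaxMatch G f := by
  classical
  obtain ⟨f, hf, h⟩ := Finset.exists_max_image (univ.filter fun f : V → V => IsMatch G f)
    (fun f => (moved f).card) ⟨id, by simp [isMatch_id]⟩
  exact ⟨f, by simpa using hf, fun g hg => h g (by simpa using hg)⟩

/-- Conjugation by a transposition. -/
lemma card_moved_conj (a b : V) :
    (moved fun v => Equiv.swap a b (f (Equiv.swap a b v))).card = (moved f).card := by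
  refine Finset.card_bij (fun v _ => Equiv.swap a b v) ?_ ?_ ?_
  · intro v hv
    rw [mem_moved] at hv ⊢
    intro h
    rw [h] at hv
    simp at hv
  · intro v _ w _ h
    exact (Equiv.swap a b).injective h
  · intro v hv
    refine ⟨Equiv.swap a b v, ?_, by simp⟩
    rw [mem_moved] at hv ⊢
    simpa using hv

/-- If `f` misses `c` and `c` is adjacent to `x`, rematch `c` with `x`, freeing `f x`. -/
lemma IsMatch.switch (hf : IsMatch G f) {c x : V} (hc : f c = c) (hx : f x ≠ x)
    (h : G.Adj c x) : ∃ g, IsMatch G g ∧ (moved g).card = (moved f).card ∧ g c = x ∧ g x = c ∧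
      g (f x) = f x ∧ ∀ v, v ≠ c → v ≠ x → v ≠ f x → g v = f v := by
  have hxc : x ≠ c := h.ne'
  have hfxc : f x ≠ c := fun h' => hxc (by rw [← hf.invol x, h', hc])
  have key : ∀ v, v ≠ c → v ≠ x → v ≠ f x →
      Equiv.swap c (f x) (f (Equiv.swap c (f x) v)) = f v := by
    intro v h1 h2 h3
    rw [Equiv.swap_apply_of_ne_of_ne h1 h3, Equiv.swap_apply_of_ne_of_ne]
    · exact fun h' => h1 (by rw [← hf.invol v, h', hc])
    · exact fun h' => h2 (hf.inj h')
  have e1 : Equiv.swap c (f x) (f (Equiv.swap c (f x) c)) = x := by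
    rw [Equiv.swap_apply_left, hf.invol, Equiv.swap_apply_of_ne_of_ne hxc hx.symm]
  have e2 : Equiv.swap c (f x) (f (Equiv.swap c (f x) x)) = c := by
    rw [Equiv.swap_apply_of_ne_of_ne hxc hx.symm, Equiv.swap_apply_right]
  have e3 : Equiv.swap c (f x) (f (Equiv.swap c (f x) (f x))) = f x := by
    rw [Equiv.swap_apply_right, hc, Equiv.swap_apply_left]
  -- Conjugating by the transposition of `c` and `f x` lets `c` take the place of `f x`, so the
  -- number of covered vertices is unchanged.
  refine ⟨fun v => Equiv.swap c (f x) (f (Equiv.swap c (f x) v)), ⟨?_, ?_⟩,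
    card_moved_conj _ _, e1, e2, e3, key⟩
  · intro v; simp [hf.invol]
  · intro v hv
    by_cases h1 : v = c
    · subst h1; rwa [e1]
    by_cases h2 : v = x
    · subst h2; rw [e2]; exact h.symm
    by_cases h3 : v = f x
    · subst h3; exact absurd e3 hv
    rw [key v h1 h2 h3] at hv ⊢
    exact hf.adj v hv

lemma IsMatch.augment (hf : IsMatch G f) {c d : V} (hc : f c = c) (hd : f d = d)
    (h : G.Adj c d) : ∃ g, IsMatch G g ∧ (moved g).card = (moved f).card + 2 ∧ g c = d ∧ g d = c ∧
      ∀ v, v ≠ c → v ≠ d → g v = f v := by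
  have hs : IsMatch G fun v => if v ∈ ({c, d} : Finset V) then
      Equiv.swap c d v else f v := by
    constructor
    · intro v
      by_cases h1 : v = c
      · subst h1; simp
      by_cases h2 : v = d
      · subst h2; simp
      have h3 : f v ≠ c := fun h' => h1 (by rw [← hf.invol v, h', hc])
      have h4 : f v ≠ d := fun h' => h2 (by rw [← hf.invol v, h', hd])
      simp [h1, h2, h3, h4, hf.invol]
    · intro v
      by_cases h1 : v = c
      · subst h1; simp [h]
      by_cases h2 : v = d
      · subst h2; simp [h.symm]
      simpa [h1, h2] using hf.adj v
  refine ⟨_, hs, ?_, by simp, by simp, fun v h1 h2 => by simp [h1, h2]⟩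
  have := card_moved_piecewise (f := f) (g := Equiv.swap c d) {c, d}
  have e1 : (({c, d} : Finset V).filter fun v => f v ≠ v) = ∅ := by
    ext v; simp only [mem_filter, mem_insert, mem_singleton]; grind
  have e2 : (({c, d} : Finset V).filter fun v => Equiv.swap c d v ≠ v) = {c, d} := by
    ext v
    simp only [mem_filter, mem_insert, mem_singleton, and_iff_left_iff_imp]
    rintro (rfl | rfl)
    · simpa using h.ne'
    · simpa using h.ne
  rw [e1, e2, card_pair h.ne] at this
  simpa using this

lemma IsMaxMatch.switch (hf : IsMaxMatch G f) {c x : V} (hc : f c = c) (hx : f x ≠ x)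
    (h : G.Adj c x) : ∃ g, IsMaxMatch G g ∧ g c = x ∧ g x = c ∧
      g (f x) = f x ∧ ∀ v, v ≠ c → v ≠ x → v ≠ f x → g v = f v := by
  obtain ⟨g, h1, h2, h3⟩ := hf.1.switch hc hx h
  exact ⟨g, ⟨h1, fun k hk => h2 ▸ hf.2 k hk⟩, h3⟩

lemma IsMaxMatch.not_adj (hf : IsMaxMatch G f) {c d : V} (hc : f c = c) (hd : f d = d) :
    ¬ G.Adj c d := by
  intro h
  obtain ⟨g, h1, h2, -⟩ := hf.1.augment hc hd h
  have := hf.2 g h1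
  omega

/-- Remove the edges of a matching inside an invariant set. -/
lemma IsMatch.clear (hf : IsMatch G f) (S : Finset V) (hS : ∀ v ∈ S, f v ∈ S) :
    ∃ g, IsMatch G g ∧ (∀ v ∈ S, g v = v) ∧ (∀ v ∉ S, g v = f v) ∧
      (moved g).card + (S.filter fun v => f v ≠ v).card = (moved f).card := by
  refine ⟨_, hf.piecewise isMatch_id S hS (fun v hv => hv), ?_, ?_, ?_⟩
  · intro v hv; simp [hv]
  · intro v hv; simp [hv]
  · have := card_moved_piecewise (f := f) (g := id) S
    simpa using this

/-- Deleting the matching inside `S` loses at most `S.card` covered vertices. The slack of one is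
allowed because the number left is even. -/
lemma hasCopy_of_invariant {l : List V} (hl : IsPath7 G l) (hf : IsMatch G f) (S : Finset V)
    (hS : ∀ v ∈ S, f v ∈ S) (hlS : ∀ v ∈ l, v ∈ S) {t : ℕ}
    (h : 2 * t + S.card ≤ (moved f).card + 1) : HasCopy G t := by
  obtain ⟨g, h1, h2, -, h4⟩ := hf.clear S hS
  refine ⟨l, g, hl, h1, fun v hv => h2 v (hlS v hv), ?_⟩
  have h5 : (S.filter fun v => f v ≠ v).card ≤ S.card := card_filter_le _ _
  obtain ⟨k, hk⟩ := h1.even_moved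
  omega

omit [DecidableEq V] [Fintype V] in
/-- A path stays in a closed set. -/
lemma chain_mem_of_closed {l : List V} (hl : l.IsChain G.Adj) {S : Finset V}
    (hS : IsClosedSet G S) (h : ∃ a ∈ l, a ∈ S) : ∀ b ∈ l, b ∈ S := by
  induction l with
  | nil => simp
  | cons x l ih =>
    cases l with
    | nil => simp_all
    | cons y l =>
      rw [List.isChain_cons_cons] at hl
      have hxy : x ∈ S ↔ y ∈ S := ⟨fun h => hS x h y hl.1, fun h => hS y h x hl.1.symm⟩
      have hy : y ∈ S := by
        obtain ⟨a, ha, haS⟩ := h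
        rcases List.mem_cons.1 ha with rfl | ha
        · exact hxy.1 haS
        · exact ih hl.2 ⟨a, ha, haS⟩ y (by simp)
      intro b hb
      rcases List.mem_cons.1 hb with rfl | hb
      · exact hxy.2 hy
      · exact ih hl.2 ⟨y, by simp, hy⟩ b hb

omit [Fintype V] in
lemma IsPath7.card_le {l : List V} (hl : IsPath7 G l) {S : Finset V} (h : ∀ b ∈ l, b ∈ S) :
    7 ≤ S.card := by
  rw [← hl.len, ← List.toFinset_card_of_nodup hl.nodup]
  exact card_le_card fun v hv => h v (by simpa using hv)

end

/-! ### Translation between `HasCopy` and subgraph containment -/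

lemma hasCopy_of_isContained {V : Type*} [Fintype V] [DecidableEq V] {G : SimpleGraph V} {t : ℕ}
    (h : pathPlusMatching 7 t ⊑ G) : HasCopy G t := by
  classical
  obtain ⟨φ⟩ := h
  have hinj : Function.Injective φ := φ.injective
  have hadj : ∀ {x y}, (pathPlusMatching 7 t).Adj x y → G.Adj (φ x) (φ y) :=
    fun h => φ.toHom.map_adj h
  let e : (Σ _ : Fin t, Fin 2) → V := fun p => φ (Sum.inr p)
  have he : Function.Injective e := fun p q h => Sum.inr_injective (hinj h)
  -- Reversing each copy of P_2 gives the involution; vertices outside these copies stay fixed.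
  let r : (Σ _ : Fin t, Fin 2) → (Σ _ : Fin t, Fin 2) := fun p => ⟨p.1, p.2.rev⟩
  let f : V → V := fun v => Function.extend e (fun p => e (r p)) id v
  have hf1 : ∀ p, f (e p) = e (r p) := fun p => he.extend_apply _ _ p
  have hf2 : ∀ v, (¬ ∃ p, e p = v) → f v = v := fun v hv => Function.extend_apply' _ _ _ hv
  have hr : ∀ p, r (r p) = p := fun p => by simp [r]
  have hr1 : ∀ p, r p ≠ p := by
    rintro ⟨i, b⟩ h
    simp only [r, Sigma.mk.injEq, heq_eq_eq, true_and] at h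
    revert h; fin_cases b <;> decide
  have hm : moved f = univ.image e := by
    ext v
    rw [mem_moved]
    constructor
    · intro h
      by_contra h'
      exact h (hf2 v fun ⟨p, hp⟩ => h' (mem_image.2 ⟨p, mem_univ _, hp⟩))
    · intro h
      obtain ⟨p, -, rfl⟩ := Finset.mem_image.1 h
      rw [hf1]
      exact fun h => hr1 p (he h)
  refine ⟨(List.finRange 7).map fun i => φ (Sum.inl i), f, ⟨by simp, ?_, ?_⟩, ⟨?_, ?_⟩, ?_, ?_⟩
  · exact (List.nodup_finRange 7).map (hinj.comp Sum.inl_injective)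
  · have : ∀ i j : Fin 7, (i : ℕ) + 1 = j → G.Adj (φ (Sum.inl i)) (φ (Sum.inl j)) := by
      intro i j hij
      apply hadj
      simp [pathPlusMatching, SimpleGraph.pathGraph_adj, hij]
    have h7 : List.finRange 7 = [0, 1, 2, 3, 4, 5, 6] := by decide
    rw [h7]
    simp only [List.map_cons, List.map_nil, List.isChain_cons_cons, List.IsChain.singleton,
      and_true]
    refine ⟨?_, ?_, ?_, ?_, ?_, ?_⟩ <;> exact this _ _ rfl
  · intro v
    by_cases h : ∃ p, e p = v
    · obtain ⟨p, rfl⟩ := h; rw [hf1, hf1, hr]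
    · rw [hf2 v h, hf2 v h]
  · intro v hv
    by_cases h : ∃ p, e p = v
    · obtain ⟨p, rfl⟩ := h
      rw [hf1]
      apply hadj
      obtain ⟨i, b⟩ := p
      simp only [pathPlusMatching, SimpleGraph.sum_adj_inr]
      refine ⟨i, b, b.rev, ?_, rfl, rfl⟩
      rw [SimpleGraph.pathGraph_adj]
      fin_cases b <;> simp
    · exact absurd (hf2 v h) hv
  · intro v hv
    obtain ⟨i, -, rfl⟩ := List.mem_map.1 hv
    apply hf2
    rintro ⟨p, hp⟩
    exact Sum.inr_ne_inl (hinj hp)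
  · rw [hm, card_image_of_injective _ he]
    simp [mul_comm]

lemma isContained_of_hasCopy {V : Type*} [Fintype V] [LinearOrder V] {G : SimpleGraph V} {t : ℕ}
    (h : HasCopy G t) : pathPlusMatching 7 t ⊑ G := by
  obtain ⟨l, f, hl, hf, hfl, hc⟩ := h
  -- The linear order selects one endpoint of each matching edge.
  let A : Finset V := univ.filter fun v => v < f v
  have hmA : moved f ⊆ A ∪ A.image f := by
    intro v hv
    rw [mem_moved] at hv
    rcases lt_or_gt_of_ne hv with h | h
    · exact mem_union_right _ (mem_image.2 ⟨f v, by simpa [A, hf.invol] using h, hf.invol v⟩)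
    · exact mem_union_left _ (by simpa [A] using h)
  have hA : t ≤ A.card := by
    have h1 := card_le_card hmA
    have h2 := card_union_le A (A.image f)
    have h3 : (A.image f).card ≤ A.card := card_image_le
    omega
  obtain ⟨B, hBA, hB⟩ := exists_subset_card_eq hA
  let e := B.orderIsoOfFin hB
  have heA : ∀ i, (e i : V) < f (e i) := fun i => by
    have := hBA (e i).2
    simpa [A] using this
  let w : Fin 7 ⊕ (Σ _ : Fin t, Fin 2) → V
    | Sum.inl i => l[(i : ℕ)]'(by rw [hl.len]; exact i.2)
    | Sum.inr ⟨i, b⟩ => if b = 0 then e i else f (e i)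
  have einj : ∀ i j, (e i : V) = e j → i = j := fun i j h => e.injective (Subtype.ext h)
  have hwm : ∀ p, f (w (Sum.inr p)) ≠ w (Sum.inr p) := by
    rintro ⟨i, b⟩
    have := (heA i).ne'
    by_cases hb : b = 0
    · simpa [w, hb] using this
    · simpa [w, hb, hf.invol] using this.symm
  refine ⟨⟨⟨w, ?_⟩, ?_⟩⟩
  · rintro (i | ⟨i, b⟩) (j | ⟨j, c⟩) h
    · simp only [pathPlusMatching, SimpleGraph.sum_adj_inl, SimpleGraph.pathGraph_adj] at h
      have hch := List.isChain_iff_getElem.1 hl.chain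
      rcases h with h | h
      · have := hch i (by have := j.2; rw [hl.len]; omega)
        simpa [w, h] using this
      · have := hch j (by have := i.2; rw [hl.len]; omega)
        simpa [w, h] using this.symm
    · simp [pathPlusMatching] at h
    · simp [pathPlusMatching] at h
    · simp only [pathPlusMatching, SimpleGraph.sum_adj_inr] at h
      obtain ⟨k, a, b', hab, h1, h2⟩ := h
      simp only [Sigma.mk.injEq, heq_eq_eq] at h1 h2
      obtain ⟨rfl, rfl⟩ := h1
      obtain ⟨rfl, rfl⟩ := h2
      have hne := hab.ne
      have hadj := hf.adj _ (heA j).ne'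
      by_cases hb : b = 0
      · have hc : c ≠ 0 := fun h => hne (hb.trans h.symm)
        simpa [w, hb, hc] using hadj
      · have hc : c = 0 := by
          revert hb hne; fin_cases b <;> fin_cases c <;> simp
        simpa [w, hb, hc] using hadj.symm
  · rintro (i | ⟨i, b⟩) (j | ⟨j, c⟩) h
    · have := (hl.nodup.getElem_inj_iff).1 (show l[(i : ℕ)]'(by rw [hl.len]; exact i.2) =
        l[(j : ℕ)]'(by rw [hl.len]; exact j.2) from h)
      rw [Fin.ext this]
    · exact absurd (by
        rw [← show w (Sum.inl i) = w (Sum.inr ⟨j, c⟩) from h]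
        exact hfl _ (List.getElem_mem _)) (hwm ⟨j, c⟩)
    · exact absurd (by
        rw [show w (Sum.inr ⟨i, b⟩) = w (Sum.inl j) from h]
        exact hfl _ (List.getElem_mem _)) (hwm ⟨i, b⟩)
    · change w (Sum.inr ⟨i, b⟩) = w (Sum.inr ⟨j, c⟩) at h
      have hi := heA i
      have hj := heA j
      by_cases hb : b = 0 <;> by_cases hc : c = 0 <;> simp only [w, hb, hc, if_true, if_false] at h
      · rw [einj i j h, hb, hc]
      · rw [h, hf.invol] at hi
        exact absurd hi hj.asymm
      · rw [← h, hf.invol] at hj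
        exact absurd hj hi.asymm
      · rw [einj i j (hf.inj h)]
        have : b = c := by
          revert hb hc; fin_cases b <;> fin_cases c <;> simp
        rw [this]

/-! ### Covering vertices of a copy by one matching -/

section
variable {V : Type*} {G : SimpleGraph V} {f g : V → V} [DecidableEq V] [Fintype V]

lemma IsMatch.augment_three (hf : IsMatch G f) {p q r s x y : V} (hn : [p, q, r, s, x, y].Nodup)
    (hfix : ∀ v ∈ [p, q, r, s, x, y], f v = v) (h1 : G.Adj p q) (h2 : G.Adj r s)
    (h3 : G.Adj x y) : ∃ g, IsMatch G g ∧ (moved g).card = (moved f).card + 6 ∧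
      ∀ v, (v ∈ [p, q, r, s, x, y] ∨ f v ≠ v) → g v ≠ v := by
  simp only [List.mem_cons, List.not_mem_nil, or_false, forall_eq_or_imp, forall_eq] at hfix
  obtain ⟨k1, k2, k3, k4, k5, k6⟩ := hfix
  simp only [List.nodup_cons, List.mem_cons, List.not_mem_nil, or_false, not_or] at hn
  obtain ⟨g1, a1, b1, c1, d1, e1⟩ := hf.augment k1 k2 h1
  obtain ⟨g2, a2, b2, c2, d2, e2⟩ := a1.augment (c := r) (d := s) (by rw [e1] <;> grind)
    (by rw [e1] <;> grind) h2
  obtain ⟨g3, a3, b3, c3, d3, e3⟩ := a2.augment (c := x) (d := y) (by rw [e2, e1] <;> grind)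
    (by rw [e2, e1] <;> grind) h3
  refine ⟨g3, a3, by omega, ?_⟩
  intro v hv
  simp only [List.mem_cons, List.not_mem_nil, or_false] at hv
  by_cases k1 : v = x
  · grind
  by_cases k2 : v = y
  · grind
  rw [e3 v k1 k2]
  by_cases k3 : v = r
  · grind
  by_cases k4 : v = s
  · grind
  rw [e2 v k3 k4]
  by_cases k5 : v = p
  · grind
  by_cases k6 : v = q
  · grind
  rw [e1 v k5 k6]
  tauto

/-- Any three vertices used by a copy are covered by a single matching. -/
lemma IsPath7.exists_cover {l : List V} (hl : IsPath7 G l) (hf : IsMatch G f)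
    (hfl : ∀ v ∈ l, f v = v) (x y z : V) :
    ∃ g, IsMatch G g ∧ (moved g).card = (moved f).card + 6 ∧
      ((x ∈ l ∨ f x ≠ x) → g x ≠ x) ∧ ((y ∈ l ∨ f y ≠ y) → g y ≠ y) ∧
      ((z ∈ l ∨ f z ≠ z) → g z ≠ z) := by
  obtain ⟨hlen, hnd, hch⟩ := hl
  match l, hlen with
  | [a0, a1, a2, a3, a4, a5, a6], _ =>
    simp only [List.isChain_cons_cons, List.IsChain.singleton, and_true] at hch
    obtain ⟨h0, h1, h2, h3, h4, h5⟩ := hch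
    have main : ∀ b, ∀ L : List V, (∀ v, v ∈ [a0, a1, a2, a3, a4, a5, a6] → v = b ∨ v ∈ L) →
        b ≠ x → b ≠ y → b ≠ z → 
        (∃ g, IsMatch G g ∧ (moved g).card = (moved f).card + 6 ∧
          ∀ v, (v ∈ L ∨ f v ≠ v) → g v ≠ v) →
        ∃ g, IsMatch G g ∧ (moved g).card = (moved f).card + 6 ∧
      ((x ∈ [a0, a1, a2, a3, a4, a5, a6] ∨ f x ≠ x) → g x ≠ x) ∧
      ((y ∈ [a0, a1, a2, a3, a4, a5, a6] ∨ f y ≠ y) → g y ≠ y) ∧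
      ((z ∈ [a0, a1, a2, a3, a4, a5, a6] ∨ f z ≠ z) → g z ≠ z) := by
      rintro b L hb hx hy hz ⟨g, k1, k2, k3⟩
      refine ⟨g, k1, k2, fun h => k3 x ?_, fun h => k3 y ?_, fun h => k3 z ?_⟩ <;>
      · refine h.imp_left fun h => (hb _ h).resolve_left ?_
        first | exact hx.symm | exact hy.symm | exact hz.symm
    -- Removing a vertex at an even position leaves six path vertices with a perfect matching. There
    -- are four such positions, so one of them avoids `x`, `y` and `z`.
    have hsel : (a0 ≠ x ∧ a0 ≠ y ∧ a0 ≠ z) ∨ (a2 ≠ x ∧ a2 ≠ y ∧ a2 ≠ z) ∨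
        (a4 ≠ x ∧ a4 ≠ y ∧ a4 ≠ z) ∨ (a6 ≠ x ∧ a6 ≠ y ∧ a6 ≠ z) := by
      simp only [List.nodup_cons, List.mem_cons, List.not_mem_nil, or_false, not_or] at hnd
      grind
    rcases hsel with ⟨hx, hy, hz⟩ | ⟨hx, hy, hz⟩ | ⟨hx, hy, hz⟩ | ⟨hx, hy, hz⟩
    · exact main a0 [a1, a2, a3, a4, a5, a6] (by simp) hx hy hz
        (hf.augment_three (by simp at hnd ⊢; tauto) (fun v hv => hfl v (by simp at hv ⊢; tauto))
          h1 h3 h5)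
    · exact main a2 [a0, a1, a3, a4, a5, a6] (by simp; try tauto) hx hy hz
        (hf.augment_three (by simp at hnd ⊢; tauto) (fun v hv => hfl v (by simp at hv ⊢; tauto))
          h0 h3 h5)
    · exact main a4 [a0, a1, a2, a3, a5, a6] (by simp; try tauto) hx hy hz
        (hf.augment_three (by simp at hnd ⊢; tauto) (fun v hv => hfl v (by simp at hv ⊢; tauto))
          h0 h2 h5)
    · exact main a6 [a0, a1, a2, a3, a4, a5] (by simp; try tauto) hx hy hz
        (hf.augment_three (by simp at hnd ⊢; tauto) (fun v hv => hfl v (by simp at hv ⊢; tauto))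
          h0 h2 h4)

end

/-! ### Saturation in the presence of isolated vertices -/

/-- Saturation for `P_7 + t P_2`, phrased with `HasCopy`. -/
structure IsCopySat {V : Type*} [Fintype V] [DecidableEq V] (G : SimpleGraph V) (t : ℕ) :
    Prop where
  free : ¬ HasCopy G t
  sat : ∀ u v, u ≠ v → ¬ G.Adj u v → HasCopy (G ⊔ SimpleGraph.edge u v) t

section
variable {V : Type*} {G : SimpleGraph V} {f g : V → V}

lemma sup_edge_adj {u x a b : V} : (G ⊔ SimpleGraph.edge u x).Adj a b ↔
    G.Adj a b ∨ (((a = u ∧ b = x) ∨ (a = x ∧ b = u)) ∧ a ≠ b) := by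
  rw [SimpleGraph.sup_adj, SimpleGraph.edge_adj]

lemma IsPath7.of_le {G' : SimpleGraph V} {l : List V} (hl : IsPath7 G l)
    (h : ∀ a ∈ l, ∀ b ∈ l, G.Adj a b → G'.Adj a b) : IsPath7 G' l :=
  ⟨hl.len, hl.nodup, hl.chain.imp_of_mem_imp fun a b ha hb => h a ha b hb⟩

variable [DecidableEq V] [Fintype V] {t : ℕ}

/-- In a copy in `G + ux` with `u` isolated, every neighbour of `x` is used. -/
lemma IsCopySat.used (hG : IsCopySat G t) {u x w : V} (hu : G.IsIsolated u) (hxw : G.Adj x w)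
    {l : List V} {g : V → V} (hl : IsPath7 (G ⊔ SimpleGraph.edge u x) l)
    (hg : IsMatch (G ⊔ SimpleGraph.edge u x) g) (hgl : ∀ v ∈ l, g v = v)
    (hc : 2 * t ≤ (moved g).card) : w ∈ l ∨ g w ≠ w := by
  by_contra! h
  obtain ⟨hwl, hgw⟩ := h
  have hux : u ≠ x := by rintro rfl; exact hu _ hxw
  have huw : u ≠ w := by rintro rfl; exact hu _ hxw.symm
  -- If `w` is unused, it can replace `u` in the copy: the only edge at `u` is `ux`, and `wx` is
  -- already an edge of `G`.
  have key : ∀ a b, a ≠ w → b ≠ w → (G ⊔ SimpleGraph.edge u x).Adj a b →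
      G.Adj (Equiv.swap u w a) (Equiv.swap u w b) := by
    intro a b ha hb hab
    rw [sup_edge_adj] at hab
    have hxw' := hxw.ne
    rcases hab with hab | ⟨⟨rfl, rfl⟩ | ⟨rfl, rfl⟩, -⟩
    · have h1 : a ≠ u := by rintro rfl; exact hu _ hab
      have h2 : b ≠ u := by rintro rfl; exact hu _ hab.symm
      rwa [Equiv.swap_apply_of_ne_of_ne h1 ha, Equiv.swap_apply_of_ne_of_ne h2 hb]
    · rw [Equiv.swap_apply_left, Equiv.swap_apply_of_ne_of_ne hux.symm hxw']
      exact hxw.symm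
    · rw [Equiv.swap_apply_left, Equiv.swap_apply_of_ne_of_ne hux.symm hxw']
      exact hxw
  apply hG.free
  refine ⟨l.map (Equiv.swap u w), fun v => Equiv.swap u w (g (Equiv.swap u w v)),
    ⟨by simp [hl.len], hl.nodup.map (Equiv.injective _), ?_⟩, ⟨?_, ?_⟩, ?_, ?_⟩
  · rw [List.isChain_map]
    refine hl.chain.imp_of_mem_imp fun a b ha hb => key a b ?_ ?_
    · rintro rfl; exact hwl ha
    · rintro rfl; exact hwl hb
  · intro v; simp [hg.invol]
  · intro v hv
    have h1 : g (Equiv.swap u w v) ≠ Equiv.swap u w v := by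
      intro h; rw [h] at hv; simp at hv
    have h2 := hg.adj _ h1
    have h3 := key _ _ (fun h => h1 (by rw [h, hgw])) (fun h => h1 (by
      rw [← hg.invol (Equiv.swap u w v), h, hgw, hgw])) h2
    simpa using h3
  · intro v hv
    obtain ⟨a, ha, rfl⟩ := List.mem_map.1 hv
    simp [hgl a ha]
  · rw [card_moved_conj]; exact hc

lemma IsCopySat.used_self (hG : IsCopySat G t) {u x : V}
    {l : List V} {g : V → V} (hl : IsPath7 (G ⊔ SimpleGraph.edge u x) l)
    (hg : IsMatch (G ⊔ SimpleGraph.edge u x) g) (hgl : ∀ v ∈ l, g v = v)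
    (hc : 2 * t ≤ (moved g).card) : u ∈ l ∨ g u ≠ u := by
  by_contra! h
  obtain ⟨hul, hgu⟩ := h
  have key : ∀ a b, a ≠ u → b ≠ u → (G ⊔ SimpleGraph.edge u x).Adj a b → G.Adj a b := by
    intro a b ha hb hab
    rw [sup_edge_adj] at hab
    tauto
  refine hG.free ⟨l, g, hl.of_le fun a ha b hb => key a b ?_ ?_, ⟨hg.invol, ?_⟩, hgl, hc⟩
  · rintro rfl; exact hul ha
  · rintro rfl; exact hul hb
  · intro v hv
    refine key _ _ ?_ ?_ (hg.adj v hv)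
    · rintro rfl; exact hv hgu
    · intro h
      have := hg.eq_comm h
      rw [hgu] at this
      exact hv (h.trans this)

/-- If `x` were the only neighbour of `w`, the copy in `G + ux` would use both `u` and `w`. A single
matching covers both, yet each can only be matched to `x`. -/
lemma IsCopySat.minDeg (hG : IsCopySat G t) {u : V} (hu : G.IsIsolated u) {w x : V}
    (hwx : G.Adj w x) : ∃ y, y ≠ x ∧ G.Adj w y := by
  by_contra! h
  have hux : u ≠ x := by rintro rfl; exact hu _ hwx.symm
  have huw : u ≠ w := by rintro rfl; exact hu _ hwx
  obtain ⟨l, g, hl, hg, hgl, hc⟩ := hG.sat u x hux (hu x)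
  have hw := hG.used hu hwx.symm hl hg hgl hc
  have hu' := hG.used_self hl hg hgl hc
  obtain ⟨k, hk, -, k1, k2, -⟩ := hl.exists_cover hg hgl u w w
  have a1 := hk.adj _ (k1 hu')
  have a2 := hk.adj _ (k2 hw)
  rw [sup_edge_adj] at a1 a2
  have e1 : k u = x := by
    rcases a1 with a1 | a1
    · exact absurd a1 (hu _)
    · grind
  have e2 : k w = x := by
    rcases a2 with a2 | a2
    · by_contra hne; exact h _ hne a2
    · have := hwx.ne
      grind
  exact huw (hk.inj (e1.trans e2.symm))

/-- The copy in `G + ua` uses `x`, `y` and `z`, so one matching covers all three. Their partners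
would be three distinct elements of `{a, d}`. -/
lemma IsCopySat.no_triple (hG : IsCopySat G t) {u : V} (hu : G.IsIsolated u) {a d x y z : V}
    (hxy : x ≠ y) (hxz : x ≠ z) (hyz : y ≠ z) (hx : G.Adj a x) (hy : G.Adj a y) (hz : G.Adj a z)
    (hx' : ∀ w, G.Adj x w → w = a ∨ w = d) (hy' : ∀ w, G.Adj y w → w = a ∨ w = d)
    (hz' : ∀ w, G.Adj z w → w = a ∨ w = d) : False := by
  have hua : u ≠ a := by rintro rfl; exact hu _ hx
  obtain ⟨l, g, hl, hg, hgl, hc⟩ := hG.sat u a hua (hu a)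
  obtain ⟨k, hk, -, k1, k2, k3⟩ := hl.exists_cover hg hgl x y z
  have main : ∀ w, G.Adj a w → (∀ v, G.Adj w v → v = a ∨ v = d) → k w ≠ w → k w = a ∨ k w = d := by
    intro w haw hw hkw
    have h1 := hk.adj _ hkw
    rw [sup_edge_adj] at h1
    rcases h1 with h1 | ⟨⟨rfl, -⟩ | ⟨rfl, -⟩, -⟩
    · exact hw _ h1
    · exact absurd haw.symm (hu _)
    · exact absurd haw (G.irrefl)
  have m1 := main x hx hx' (k1 (hG.used hu hx hl hg hgl hc))
  have m2 := main y hy hy' (k2 (hG.used hu hy hl hg hgl hc))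
  have m3 := main z hz hz' (k3 (hG.used hu hz hl hg hgl hc))
  have n1 : k x ≠ k y := fun h => hxy (hk.inj h)
  have n2 : k x ≠ k z := fun h => hxz (hk.inj h)
  have n3 : k y ≠ k z := fun h => hyz (hk.inj h)
  grind

/-- The new edge is a component with two vertices. It cannot meet the path, and discarding it costs
at most one matching edge. -/
lemma IsCopySat.hasCopy_pred (hG : IsCopySat G t) {u v : V} (huv : u ≠ v) (hu : G.IsIsolated u)
    (hv : G.IsIsolated v) : HasCopy G (t - 1) := by
  obtain ⟨l, g, hl, hg, hgl, hc⟩ := hG.sat u v huv (hu v)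
  have hcl : IsClosedSet (G ⊔ SimpleGraph.edge u v) {u, v} := by
    intro a ha w haw
    rw [sup_edge_adj] at haw
    simp only [mem_insert, mem_singleton] at ha ⊢
    rcases haw with haw | haw
    · rcases ha with rfl | rfl
      · exact absurd haw (hu _)
      · exact absurd haw (hv _)
    · tauto
  have hnl : ∀ a ∈ l, a ∉ ({u, v} : Finset V) := by
    intro a ha ha'
    have := hl.card_le (chain_mem_of_closed hl.chain hcl ⟨a, ha, ha'⟩)
    have := card_le_two (a := u) (b := v)
    omega
  have key : ∀ a b, a ∉ ({u, v} : Finset V) → (G ⊔ SimpleGraph.edge u v).Adj a b → G.Adj a b := by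
    intro a b ha hab
    rw [sup_edge_adj] at hab
    simp only [mem_insert, mem_singleton] at ha
    tauto
  obtain ⟨k, hk, k1, k2, k3⟩ := hg.clear {u, v} (fun a ha => by
    by_cases h : g a = a
    · rwa [h]
    · exact hcl a ha _ (hg.adj a h))
  refine ⟨l, k, hl.of_le fun a ha b _ => key a b (hnl a ha), ⟨hk.invol, ?_⟩, ?_, ?_⟩
  · intro a ha
    exact key _ _ (fun h => ha (k1 a h)) (hk.adj a ha)
  · intro a ha
    rw [k2 a (hnl a ha), hgl a ha]
  · have h1 := card_filter_le ({u, v} : Finset V) (fun a => g a ≠ a)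
    have := card_le_two (a := u) (b := v)
    omega

lemma HasCopy.exists_isMatch (h : HasCopy G t) : ∃ f, IsMatch G f ∧ 2 * t + 6 ≤ (moved f).card := by
  obtain ⟨l, g, hl, hg, hgl, hc⟩ := h
  have hne : l ≠ [] := by rintro rfl; simpa using hl.len
  obtain ⟨x, -⟩ := List.exists_mem_of_ne_nil l hne
  obtain ⟨k, hk, h2, -⟩ := hl.exists_cover hg hgl x x x
  exact ⟨k, hk, by omega⟩

/-- No seven-vertex path is invariant under a maximum matching. -/
def NoCheap (G : SimpleGraph V) : Prop :=
  ∀ f, IsMaxMatch G f → ∀ l, IsPath7 G l → (∀ v ∈ l, f v ∈ l) → False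

/-- An invariant set of seven vertices has at most six covered, so at least 2t covered vertices
remain outside the path. -/
lemma IsCopySat.noCheap (hG : IsCopySat G t) (h : ∃ f, IsMatch G f ∧ 2 * t + 6 ≤ (moved f).card) :
    NoCheap G := by
  intro f hf l hl hfl
  obtain ⟨k, hk, hk'⟩ := h
  refine hG.free (hasCopy_of_invariant hl hf.1 l.toFinset (by simpa using hfl) (by simp) ?_)
  have h1 := hf.2 k hk
  rw [List.toFinset_card_of_nodup hl.nodup, hl.len]
  omega

end

/-! ### Missable vertices: propagation along edges and short alternating paths -/

section
variable {V : Type*} {G : SimpleGraph V} {f g : V → V} [DecidableEq V] [Fintype V] {t : ℕ}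

/-- Some maximum matching misses `v`. -/
def Missable (G : SimpleGraph V) (v : V) : Prop := ∃ f, IsMaxMatch G f ∧ f v = v

lemma NoCheap.elim (h : NoCheap G) (hf : IsMaxMatch G f) {a b c d e x y : V}
    (hn : [a, b, c, d, e, x, y].Nodup) (h1 : G.Adj a b) (h2 : G.Adj b c) (h3 : G.Adj c d)
    (h4 : G.Adj d e) (h5 : G.Adj e x) (h6 : G.Adj x y)
    (hinv : ∀ v ∈ [a, b, c, d, e, x, y], f v ∈ [a, b, c, d, e, x, y]) : False :=
  h f hf _ ⟨rfl, hn, by simp [h1, h2, h3, h4, h5, h6]⟩ hinv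

/-- Suppose a maximum matching `f` misses `c` while every maximum matching covers its neighbour `a`;
let `m = f a`. By minimum degree two, `c` has another neighbour `d`. Invariant seven-vertex paths
through `c` and the edges at `a` and `d` are forbidden, which confines the neighbourhoods of `c`,
`m` and `f d` to `{a, d}`. All three are adjacent to `a`, contradicting `IsCopySat.no_triple`. -/
lemma IsCopySat.missable_of_adj (hG : IsCopySat G t) (hnc : NoCheap G) {u : V}
    (hu : G.IsIsolated u) {c a : V} (hc : Missable G c) (hca : G.Adj c a) : Missable G a := by
  by_contra hna
  have hδ := fun w x => hG.minDeg hu (w := w) (x := x)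
  obtain ⟨f, hf, hfc⟩ := hc
  have hnot : ∀ g, IsMaxMatch G g → g a ≠ a := fun g hg h => hna ⟨g, hg, h⟩
  have hinv := hf.1.invol
  have hfa := hnot f hf
  obtain ⟨m, hm⟩ : ∃ m, f a = m := ⟨_, rfl⟩
  have hma : f m = a := by rw [← hm, hinv]
  have ham : G.Adj a m := hm ▸ hf.1.adj a hfa
  have hac := hca.ne
  have hmc : m ≠ c := by grind
  have hmne : m ≠ a := by grind
  have hcm : ¬ G.Adj c m := by
    intro h
    obtain ⟨g, g1, g2, g3, g4, g5⟩ := hf.switch hfc (by grind) h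
    exact hnot g g1 (by grind)
  obtain ⟨g, g1, g2, g3, g4, g5⟩ := hf.switch hfc hfa hca
  rw [hm] at g4 g5
  -- A further neighbour `e` of `m` or of `f d` would extend the path through `f d, d, c, a, m` at
  -- one end by `e, f e`, giving an invariant path on seven vertices; if `e` were missed, an
  -- augmentation would exist.
  have step : ∀ d, G.Adj c d → d ≠ a → (∀ e, G.Adj m e → e = a ∨ e = d ∨ e = f d) ∧
      (∀ e, G.Adj (f d) e → e = a ∨ e = d ∨ e = c) ∧ f d ≠ d := by
    intro d hcd hda
    have hfd : f d ≠ d := fun h => hf.not_adj hfc h hcd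
    obtain ⟨d', hd'⟩ : ∃ d', f d = d' := ⟨_, rfl⟩
    have hdd' : f d' = d := by rw [← hd', hinv]
    have hadd : G.Adj d d' := hd' ▸ hf.1.adj d hfd
    have hdc := hcd.ne
    have hdm : d ≠ m := by rintro rfl; exact hcm hcd
    rw [hd'] at hfd ⊢
    have hd'c : d' ≠ c := by grind
    have hd'a : d' ≠ a := by grind
    have hd'm : d' ≠ m := by grind
    obtain ⟨k, k1, k2, k3, k4, k5⟩ := hf.switch hfc (by rwa [hd']) hcd
    rw [hd'] at k4 k5
    refine ⟨fun e he => ?_, fun e he => ?_, hfd⟩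
    · by_contra! hne
      obtain ⟨e1, e2, e3⟩ := hne
      have hec : e ≠ c := by rintro rfl; exact hcm he.symm
      have hem := he.ne
      have hge : g e = f e := g5 e hec e1 hem.symm
      have hfe : f e ≠ e := fun h => g1.not_adj g4 (hge.trans h) he
      obtain ⟨e', he'⟩ : ∃ e', f e = e' := ⟨_, rfl⟩
      have hee' : f e' = e := by rw [← he', hinv]
      have haee : G.Adj e e' := he' ▸ hf.1.adj e hfe
      refine hnc.elim hf (a := d') (b := d) (c := c) (d := a) (e := m) (x := e) (y := e') ?_
        hadd.symm hcd.symm hca ham he haee ?_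
      · simp; grind
      · simp [*]
    · by_contra! hne
      obtain ⟨e1, e2, e3⟩ := hne
      -- An edge from `f d` to `m` would allow `c` to be matched with `d` and `f d` with `m`, which
      -- frees `a`.
      by_cases hem : e = m
      · subst hem
        obtain ⟨r, r1, r2, r3, r4, r5⟩ := k1.switch k4 (x := e) (by grind) he
        exact hnot r r1 (by grind)
      have hed := he.ne
      have hke : k e = f e := k5 e e3 e2 hed.symm
      have hfe : f e ≠ e := fun h => k1.not_adj k4 (hke.trans h) he
      obtain ⟨e', he'⟩ : ∃ e', f e = e' := ⟨_, rfl⟩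
      have hee' : f e' = e := by rw [← he', hinv]
      have haee : G.Adj e e' := he' ▸ hf.1.adj e hfe
      refine hnc.elim hf (a := m) (b := a) (c := c) (d := d) (e := d') (x := e) (y := e') ?_
        ham.symm hca.symm hcd hadd he haee ?_
      · simp; grind
      · simp [*]
  obtain ⟨d, hda, hcd⟩ := hδ c a hca
  obtain ⟨s1, s2, s3⟩ := step d hcd hda
  have hmd' : ¬ G.Adj m (f d) := by
    intro h
    rcases s2 m h.symm with h | h | h
    · exact hmne h
    · exact hcm (h ▸ hcd)
    · exact hmc h
  have hmN : ∀ e, G.Adj m e → e = a ∨ e = d := fun e he => by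
    rcases s1 e he with h | h | h
    · exact Or.inl h
    · exact Or.inr h
    · exact absurd (h ▸ he) hmd'
  have hmd : G.Adj m d := by
    obtain ⟨e, e1, e2⟩ := hδ m a ham.symm
    rcases hmN e e2 with h | h
    · exact absurd h e1
    · exact h ▸ e2
  -- For a third neighbour `e` of `c`, the bounds in `step` applied to `e` force `d = f e`, and then
  -- the edge `md` violates the bound on the neighbours of `f e`.
  have huniq : ∀ e, G.Adj c e → e = a ∨ e = d := by
    intro e he
    by_contra! hne
    obtain ⟨p1, p2, p3⟩ := step e he hne.1
    rcases p1 d hmd with h | h | h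
    · exact hda h
    · exact hne.2 h.symm
    · rcases p2 m (by rw [← h]; exact hmd.symm) with h | h | h
      · exact hmne h
      · exact hcm (h ▸ he)
      · exact hmc h
  have hd'c : ¬ G.Adj c (f d) := by
    intro h
    rcases huniq _ h with h' | h'
    · exact hcm (by
        have : d = m := by rw [← hm, ← h', hinv]
        exact this ▸ hcd)
    · exact s3 h'
  have hd'N : ∀ e, G.Adj (f d) e → e = a ∨ e = d := fun e he => by
    rcases s2 e he with h | h | h
    · exact Or.inl h
    · exact Or.inr h
    · exact absurd (h ▸ he).symm hd'c
  have hd'a : G.Adj (f d) a := by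
    obtain ⟨e, e1, e2⟩ := hδ (f d) d (hf.1.adj d s3).symm
    rcases hd'N e e2 with h | h
    · exact h ▸ e2
    · exact absurd h e1
  refine hG.no_triple hu (a := a) (d := d) (x := c) (y := m) (z := f d) hmc.symm ?_ ?_
    hca.symm ham hd'a.symm huniq hmN hd'N
  · intro h
    have := hinv d
    grind
  · intro h
    exact hda (by rw [← hinv d, ← h, hma])

/-- A maximum matching reaches a missable vertex by a short even alternating path. -/
lemma NoCheap.short_reach (hnc : NoCheap G) (hf : IsMaxMatch G f) {x : V} (hx : Missable G x)
    (hfx : f x ≠ x) : (∃ c, f c = c ∧ G.Adj (f x) c) ∨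
      ∃ y c, y ≠ x ∧ y ≠ f x ∧ f y ≠ y ∧ G.Adj (f x) y ∧ G.Adj (f y) c ∧ f c = c := by
  obtain ⟨h, hh, hhx⟩ := hx
  have hinv := hf.1.invol
  have hinv' := hh.1.invol
  obtain ⟨z1, hz1⟩ : ∃ z, f x = z := ⟨_, rfl⟩
  have b1 : f z1 = x := by rw [← hz1, hinv]
  have e1 : G.Adj x z1 := hz1 ▸ hf.1.adj x hfx
  rw [hz1] at hfx ⊢
  have c1 : h z1 ≠ z1 := fun h' => hh.not_adj hhx h' e1
  obtain ⟨z2, hz2⟩ : ∃ z, h z1 = z := ⟨_, rfl⟩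
  have b2 : h z2 = z1 := by rw [← hz2, hinv']
  have e2 : G.Adj z1 z2 := hz2 ▸ hh.1.adj z1 c1
  rw [hz2] at c1
  by_cases hf2 : f z2 = z2
  · exact Or.inl ⟨z2, hf2, e2⟩
  right
  obtain ⟨z3, hz3⟩ : ∃ z, f z2 = z := ⟨_, rfl⟩
  have b3 : f z3 = z2 := by rw [← hz3, hinv]
  have e3 : G.Adj z2 z3 := hz3 ▸ hf.1.adj z2 hf2
  rw [hz3] at hf2
  have n2 : z2 ≠ x := by grind
  have n3 : z3 ≠ x := by grind
  have n31 : z3 ≠ z1 := by grind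
  -- The walk alternates between `f` and `h`. Moving the hole of `h` from `x` to `z2` shows that `h`
  -- covers `z3`: otherwise two adjacent vertices would be missed. The same device is used once more
  -- at `z5`.
  obtain ⟨h1, p1, p2, p3, p4, p5⟩ := hh.switch hhx (x := z1) (by rwa [hz2]) e1
  rw [hz2] at p4 p5
  have c3 : h z3 ≠ z3 := fun h' => p1.not_adj p4 (by rw [p5, h'] <;> grind) e3
  obtain ⟨z4, hz4⟩ : ∃ z, h z3 = z := ⟨_, rfl⟩
  have b4 : h z4 = z3 := by rw [← hz4, hinv']
  have e4 : G.Adj z3 z4 := hz4 ▸ hh.1.adj z3 c3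
  rw [hz4] at c3
  by_cases hf4 : f z4 = z4
  · exact ⟨z2, z4, n2, c1, by rwa [hz3], e2, by rwa [hz3], hf4⟩
  exfalso
  obtain ⟨z5, hz5⟩ : ∃ z, f z4 = z := ⟨_, rfl⟩
  have b5 : f z5 = z4 := by rw [← hz5, hinv]
  have e5 : G.Adj z4 z5 := hz5 ▸ hf.1.adj z4 hf4
  rw [hz5] at hf4
  have n4 : z4 ≠ x := by grind
  have n41 : z4 ≠ z1 := by grind
  have n42 : z4 ≠ z2 := by grind
  have n5 : z5 ≠ x := by grind
  have n51 : z5 ≠ z1 := by grind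
  have n52 : z5 ≠ z2 := by grind
  have n53 : z5 ≠ z3 := by grind
  have q3 : h1 z3 = z4 := by rw [p5, hz4] <;> grind
  obtain ⟨h2, q1, q2, q3', q4, q5⟩ := p1.switch p4 (x := z3) (by rwa [q3]) e3
  rw [q3] at q4 q5
  have c5 : h z5 ≠ z5 := fun h' => q1.not_adj q4 (by rw [q5, p5, h'] <;> grind) e5
  obtain ⟨z6, hz6⟩ : ∃ z, h z5 = z := ⟨_, rfl⟩
  have b6 : h z6 = z5 := by rw [← hz6, hinv']
  have e6 : G.Adj z5 z6 := hz6 ▸ hh.1.adj z5 c5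
  -- A walk reaching `z6` is invariant under `h`, since `h` fixes `x` and pairs the other six
  -- vertices consecutively.
  refine hnc.elim hh (a := x) (b := z1) (c := z2) (d := z3) (e := z4) (x := z5) (y := z6) ?_
    e1 e2 e3 e4 e5 e6 ?_
  · simp; grind
  · simp [*]

end

/-! ### Components of missable vertices: five vertices or a fan -/

section
variable {V : Type*} {G : SimpleGraph V} {f g : V → V} [DecidableEq V] [Fintype V] {t : ℕ}

/-- A closed set of five vertices, of which some maximum matching covers four. -/
def IsFive (G : SimpleGraph V) (S : Finset V) : Prop :=
  S.card = 5 ∧ IsClosedSet G S ∧ ∃ f, IsMaxMatch G f ∧ (S.filter fun v => f v ≠ v).card = 4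

/-- The component of `z` is a fan centred at `z`, with the blades matched by `g`. -/
structure IsFan (G : SimpleGraph V) (z : V) (g : V → V) : Prop where
  max : IsMaxMatch G g
  fix : g z = z
  adj : ∀ v, G.Adj z v → G.Adj z (g v)
  nbr : ∀ v, G.Adj z v → ∀ w, G.Adj v w → w = z ∨ w = g v

/-- Consider an edge from the 5-cycle to an outside vertex `e`. If `f` covers `e`, then `f e`, `e`
and the cycle opened at the point of contact form an invariant P_7. If `f` misses `e`, rotating the
hole around the cycle to the point of contact gives two adjacent missed vertices. -/
lemma NoCheap.five (hnc : NoCheap G) (hf : IsMaxMatch G f) {c x x' y y' : V} (hc : f c = c)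
    (hx : f x = x') (hy : f y = y') (hxx : x ≠ x') (hyy : y ≠ y') (hyx : y ≠ x) (hyx' : y ≠ x')
    (h1 : G.Adj c x) (h2 : G.Adj x' y) (h3 : G.Adj y' c) : IsFive G {c, x, x', y, y'} := by
  have hinv := hf.1.invol
  have hx' : f x' = x := by rw [← hx, hinv]
  have hy' : f y' = y := by rw [← hy, hinv]
  have a1 : G.Adj x x' := hx ▸ hf.1.adj x (by rw [hx]; exact hxx.symm)
  have a2 : G.Adj y y' := hy ▸ hf.1.adj y (by rw [hy]; exact hyy.symm)
  have n1 : c ≠ x := h1.ne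
  have n2 : c ≠ x' := by grind
  have n3 : c ≠ y := by grind
  have n4 : c ≠ y' := by grind
  have n5 : y' ≠ x := by grind
  have n6 : y' ≠ x' := by grind
  have hcard : ({c, x, x', y, y'} : Finset V).card = 5 := by
    rw [card_insert_of_notMem, card_insert_of_notMem, card_insert_of_notMem, card_pair hyy] <;>
    · simp; grind
  refine ⟨hcard, ?_, f, hf, ?_⟩
  · obtain ⟨k, k1, k2, k3, k4, k5⟩ := hf.switch hc (by rw [hx]; exact hxx.symm) h1
    rw [hx] at k4 k5
    obtain ⟨r, r1, r2, r3, r4, r5⟩ := hf.switch (x := y') hc (by rw [hy']; exact hyy) h3.symm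
    rw [hy'] at r4 r5
    intro v hv e hve
    by_contra he
    simp only [mem_insert, mem_singleton, not_or] at he hv
    obtain ⟨m1, m2, m3, m4, m5⟩ := he
    have hfe : f e ≠ e := by
      intro hfe
      have ke : k e = e := by rw [k5, hfe] <;> assumption
      have re : r e = e := by rw [r5, hfe] <;> assumption
      rcases hv with rfl | rfl | rfl | rfl | rfl
      · exact hf.not_adj hc hfe hve
      · obtain ⟨s, s1, s2, s3, s4, s5⟩ := r1.switch (x := v) re
          (by rw [r5, hx] <;> first | assumption | exact hxx.symm | exact n1.symm | grind) hve.symm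
        have rv : r v = x' := by rw [r5, hx] <;> grind
        rw [rv] at s4 s5
        exact s1.not_adj s4 (by rw [s5, r4] <;> grind) h2
      · exact k1.not_adj k4 ke hve
      · exact r1.not_adj r4 re hve
      · obtain ⟨s, s1, s2, s3, s4, s5⟩ := k1.switch (x := v) ke
          (by rw [k5, hy'] <;> first | assumption | exact n4.symm) hve.symm
        have kv : k v = y := by rw [k5, hy'] <;> grind
        rw [kv] at s4 s5
        exact s1.not_adj s4 (by rw [s5, k4] <;> grind) h2.symm
    obtain ⟨e', he'⟩ : ∃ e', f e = e' := ⟨_, rfl⟩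
    have hee' : f e' = e := by rw [← he', hinv]
    have ae : G.Adj e' e := (he' ▸ hf.1.adj e hfe).symm
    rw [he'] at hfe
    have o1 : e' ≠ c := by grind
    have o2 : e' ≠ x := by grind
    have o3 : e' ≠ x' := by grind
    have o4 : e' ≠ y := by grind
    have o5 : e' ≠ y' := by grind
    rcases hv with rfl | rfl | rfl | rfl | rfl
    · exact hnc.elim hf (by simp; grind) ae hve.symm h1 a1 h2 a2 (by simp [*])
    · exact hnc.elim hf (by simp; grind) ae hve.symm a1 h2 a2 h3 (by simp [*])
    · exact hnc.elim hf (by simp; grind) ae hve.symm h2 a2 h3 h1 (by simp [*])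
    · exact hnc.elim hf (by simp; grind) ae hve.symm a2 h3 h1 a1 (by simp [*])
    · exact hnc.elim hf (by simp; grind) ae hve.symm h3 h1 a1 h2 (by simp [*])
  · have : (({c, x, x', y, y'} : Finset V).filter fun v => f v ≠ v) =
        ({c, x, x', y, y'} : Finset V).erase c := by
      ext v
      simp only [mem_filter, mem_erase, mem_insert, mem_singleton]
      grind
    rw [this, card_erase_of_mem (by simp), hcard]

/-- If there is no five-cycle through `c`, every neighbour of `c` lies in a triangle. -/
lemma NoCheap.triangle (hnc : NoCheap G) (hD : ∀ v w, Missable G v → G.Adj v w → Missable G w)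
    (hf : IsMaxMatch G f) {c : V} (hc : f c = c) (h5 : ∀ S, IsFive G S → c ∉ S) {x : V}
    (hcx : G.Adj c x) : G.Adj c (f x) ∧ f x ≠ x := by
  have hinv := hf.1.invol
  have hfx : f x ≠ x := fun h => hf.not_adj hc h hcx
  refine ⟨?_, hfx⟩
  obtain ⟨g, g1, g2, g3, g4, g5⟩ := hf.switch hc hfx hcx
  rcases hnc.short_reach hf (hD c x ⟨f, hf, hc⟩ hcx) hfx with
    ⟨c', e1, e2⟩ | ⟨y, c', e1, e2, e3, e4, e5, e6⟩
  · by_cases hcc : c' = c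
    · exact hcc ▸ e2.symm
    · exact absurd e2 (g1.not_adj g4 (by
        rw [g5 c' hcc (by rintro rfl; exact hfx e1) (e2.ne'), e1]))
  · have hyc : y ≠ c := by rintro rfl; exact e3 hc
    by_cases hcc : c' = c
    · subst hcc
      exact absurd (by simp) (h5 _ (hnc.five hf hc rfl rfl hfx.symm (Ne.symm e3) e1 e2 hcx e4 e5))
    · exfalso
      have gy : g y = f y := g5 y hyc e1 e2
      obtain ⟨s, s1, s2, s3, s4, s5⟩ := g1.switch g4 (x := y) (by rw [gy]; exact e3) e4
      rw [gy] at s4 s5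
      refine s1.not_adj s4 ?_ e5
      rw [s5, g5, e6] <;> grind

/-- If there is no five-cycle, paths of length two from `c` stay in triangles at the middle. -/
lemma NoCheap.second_triangle (hnc : NoCheap G)
    (hD : ∀ v w, Missable G v → G.Adj v w → Missable G w)
    (hf : IsMaxMatch G f) {c : V} (hc : f c = c) (h5 : ∀ S, IsFive G S → c ∉ S) {x e : V}
    (hcx : G.Adj c x) (hxe : G.Adj x e) (hec : e ≠ c) (hex : e ≠ f x) :
    G.Adj x (f e) ∧ f e ≠ e ∧ ¬ G.Adj c e := by
  have hinv := hf.1.invol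
  have tri := fun v (h : G.Adj c v) => hnc.triangle hD hf hc h5 h
  obtain ⟨hcx', hfx⟩ := tri x hcx
  obtain ⟨x', hx'⟩ : ∃ z, f x = z := ⟨_, rfl⟩
  have hx'' : f x' = x := by rw [← hx', hinv]
  have axx : G.Adj x x' := hx' ▸ hf.1.adj x hfx
  rw [hx'] at hcx' hfx hex
  have hnex := hxe.ne
  have ncx := hcx.ne
  have ncx' := hcx'.ne
  obtain ⟨g, g1, g2, g3, g4, g5⟩ := hf.switch (x := x') hc (by rw [hx'']; exact hfx.symm) hcx'
  rw [hx''] at g4 g5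
  have hge : g e = f e := g5 e hec hex hnex.symm
  have hfe : f e ≠ e := fun h => g1.not_adj g4 (hge.trans h) hxe
  obtain ⟨e', he'⟩ : ∃ z, f e = z := ⟨_, rfl⟩
  have hee' : f e' = e := by rw [← he', hinv]
  have aee : G.Adj e e' := he' ▸ hf.1.adj e hfe
  rw [he'] at hfe hge ⊢
  have n1 : e' ≠ c := by grind
  have n2 : e' ≠ x := by grind
  have n3 : e' ≠ x' := by grind
  have hce' : ¬ G.Adj c e' := by
    intro h
    refine h5 _ (hnc.five hf (c := c) (x := x') (x' := x) (y := e) (y' := e') hc hx'' he' hfx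
      hfe.symm hex hnex.symm hcx' hxe h.symm) (by simp)
  have hce : ¬ G.Adj c e := fun h => hce' (he' ▸ (tri e h).1)
  refine ⟨?_, hfe, hce⟩
  obtain ⟨s, s1, s2, s3, s4, s5⟩ := g1.switch g4 (x := e) (by rw [hge]; exact hfe) hxe
  rw [hge] at s4 s5
  rcases hnc.short_reach hf (hD x e (hD c x ⟨f, hf, hc⟩ hcx) hxe) (by rwa [he']) with
    ⟨c', e1, e2⟩ | ⟨y, c', e1, e2, e3, e4, e5, e6⟩
  · rw [he'] at e2
    exfalso
    have hcc : c' ≠ c := by rintro rfl; exact hce' e2.symm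
    refine s1.not_adj s4 ?_ e2
    rw [s5, g5, e1] <;> grind
  · rw [he'] at e2 e4
    by_cases hyx : y = x
    · subst hyx; exact e4.symm
    exfalso
    by_cases hyx' : y = x'
    · subst hyx'
      -- Three exchanges produce a maximum matching with edges `xe` and `e'y` that again misses `c`;
      -- it fits the 5-cycle `c, x, e, e', y`.
      obtain ⟨p, p1, p2, p3, p4, p5⟩ := hf.switch hc (by rw [hx']; exact hfx) hcx
      rw [hx'] at p4 p5
      have pe' : p e' = e := by rw [p5, hee'] <;> assumption
      obtain ⟨q, q1, q2, q3, q4, q5⟩ := p1.switch p4 (x := e') (by rw [pe']; exact hfe.symm) e4.symm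
      rw [pe'] at q4 q5
      have qx : q x = c := by rw [q5, p3] <;> grind
      obtain ⟨r, r1, r2, r3, r4, r5⟩ := q1.switch q4 (x := x) (by rw [qx]; exact ncx) hxe.symm
      rw [qx] at r4 r5
      have re' : r e' = y := by rw [r5, q3] <;> grind
      refine h5 _ (hnc.five r1 (c := c) (x := x) (x' := e) (y := e') (y' := y) r4 r3 re' hnex
        n3 n2 hfe hcx aee hcx'.symm) (by simp)
    · obtain ⟨y', hy'⟩ : ∃ z, f y = z := ⟨_, rfl⟩
      have hyy' : f y' = y := by rw [← hy', hinv]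
      have ayy : G.Adj y y' := hy' ▸ hf.1.adj y e3
      have hyc : y ≠ c := by grind
      rw [hy'] at e3
      exact hnc.elim hf (a := c) (b := x') (c := x) (d := e) (e := e') (x := y) (y := y')
        (by simp; grind) hcx' axx.symm hxe aee e4 ayy (by simp [*])

/-- Outside the five-vertex case every neighbour of `c` lies with its partner in a triangle at `c`.
If no neighbour sees anything else, `c` is the centre. Otherwise a neighbour `x` with a further
neighbour is the centre: it has two blades, and an edge leaving a third or either of these would
complete an invariant P_7. -/
lemma NoCheap.five_or_fan (hnc : NoCheap G)
    (hD : ∀ v w, Missable G v → G.Adj v w → Missable G w)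
    (hf : IsMaxMatch G f) {c : V} (hc : f c = c) :
    (∃ S, IsFive G S ∧ c ∈ S) ∨ ∃ z g, IsFan G z g ∧ (c = z ∨ G.Adj z c) := by
  rw [or_iff_not_imp_left]
  intro h5'
  push Not at h5'
  by_cases hα : ∀ x, G.Adj c x → ∀ w, G.Adj x w → w = c ∨ w = f x
  · exact ⟨c, f, ⟨hf, hc, fun v hv => (hnc.triangle hD hf hc h5' hv).1, hα⟩, Or.inl rfl⟩
  push Not at hα
  obtain ⟨x, hcx, e, hxe, hec, hex⟩ := hα
  obtain ⟨q1, q2, q3⟩ := hnc.second_triangle hD hf hc h5' hcx hxe hec hex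
  obtain ⟨r1, r2⟩ := hnc.triangle hD hf hc h5' hcx
  have hinv := hf.1.invol
  have hx' : f (f x) = x := hinv x
  -- The hole moves from `c` to `x`; afterwards `{c, f x}` and `{e, f e}` are blades at `x`.
  obtain ⟨g, g1, g2, g3, g4, g5⟩ := hf.switch (x := f x) hc (by rw [hx']; exact r2.symm) r1
  rw [hx'] at g4 g5
  have hinvg := g1.1.invol
  have hge : g e = f e := g5 e hec hex hxe.ne'
  have h5x : ∀ S, IsFive G S → x ∉ S := fun S hS hxS => h5' S hS (hS.2.1 x hxS c hcx.symm)
  refine ⟨x, g, ⟨g1, g4, fun v hv => (hnc.triangle hD g1 g4 h5x hv).1, ?_⟩, Or.inr hcx.symm⟩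
  intro v hxv w hvw
  by_contra! hne
  obtain ⟨n1, n2⟩ := hne
  obtain ⟨t1, t2, t3⟩ := hnc.second_triangle hD g1 g4 h5x hxv hvw n1 n2
  obtain ⟨t4, t5⟩ := hnc.triangle hD g1 g4 h5x hxv
  have agv := g1.1.adj v t5
  have agw := g1.1.adj w t2
  have nwx : ∀ p, G.Adj x p → p ≠ w := by rintro p hp rfl; exact t3 hp
  -- One of the two known blades differs from the blade of `v`.
  have pair : ∃ p, G.Adj x p ∧ G.Adj x (g p) ∧ g p ≠ p ∧ p ≠ v ∧ p ≠ g v := by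
    have axx := hf.1.adj x r2
    by_cases h : c ≠ v ∧ c ≠ g v
    · exact ⟨c, hcx.symm, by rw [g2]; exact axx, by rw [g2]; exact r1.ne', h⟩
    · refine ⟨e, hxe, by rw [hge]; exact q1, by rw [hge]; exact q2, ?_, ?_⟩
      · rintro rfl
        grind
      · rintro rfl
        grind
  obtain ⟨p, p1, p2, p3, p4, p5⟩ := pair
  have app := g1.1.adj p p3
  have m1 := nwx p p1
  have m2 := nwx _ p2
  have m3 := nwx v hxv
  have m4 := nwx _ t4
  have m5 := hxv.ne
  have m6 := p1.ne
  have m7 := p2.ne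
  have m8 := t4.ne
  refine hnc.elim g1 (a := g w) (b := w) (c := v) (d := g v) (e := x) (x := p) (y := g p) ?_
    agw.symm hvw.symm agv t4.symm p1 app ?_
  · simp; grind
  · simp [hinvg, g4]

end

/-! ### Frugal paths in a perfectly matched component -/

section
variable {V : Type*} {G : SimpleGraph V} {f g : V → V} [DecidableEq V] [Fintype V] {t : ℕ}

/-- `S` is (the vertex set of) a connected component of `G`. -/
def IsComp (G : SimpleGraph V) (S : Finset V) : Prop :=
  S.Nonempty ∧ IsClosedSet G S ∧ ∀ T, IsClosedSet G T → (∃ v ∈ S, v ∈ T) → S ⊆ T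

/-- The matching edge `{x, f x}` is passed by the path `y, x, f x, z`. -/
def Through (G : SimpleGraph V) (f : V → V) (x y z : V) : Prop :=
  G.Adj x y ∧ G.Adj (f x) z ∧ y ≠ f x ∧ z ≠ x ∧ z ≠ y ∧ z ≠ f y

/-- Some path on seven vertices meets at most four edges of the matching `f`. -/
def HasFrugalPath (G : SimpleGraph V) (f : V → V) : Prop :=
  ∃ (l S : List V), IsPath7 G l ∧ S.length ≤ 8 ∧ (∀ v ∈ S, f v ∈ S) ∧ ∀ v ∈ l, v ∈ S

lemma Through.symm (hf : IsMatch G f) {x y z : V} (h : Through G f x y z) :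
    Through G f (f x) z y := by
  obtain ⟨h1, h2, h3, h4, h5, h6⟩ := h
  refine ⟨h2, by rwa [hf.invol], by rwa [hf.invol], h3, h5.symm, fun h => h6 ?_⟩
  rw [h, hf.invol]

/-- A neighbour `w` outside the three matching edges would prolong the path beyond `y`, either as `f
w, w, y, x, f x, z, f z` or as `w, f y, y, x, f x, z, f z`. Both meet only four matching edges. -/
lemma Through.nbr (hf : IsMatch G f) (hno : ¬ HasFrugalPath G f) {Q : Finset V}
    (hQ : IsClosedSet G Q) (hfQ : ∀ v ∈ Q, f v ≠ v) {x y z : V} (hx : x ∈ Q)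
    (h : Through G f x y z) {w : V} (hw : G.Adj y w ∨ G.Adj (f y) w) :
    w = x ∨ w = f x ∨ w = y ∨ w = f y ∨ w = z ∨ w = f z := by
  by_contra! hne
  obtain ⟨h1, h2, h3, h4, h5, h6⟩ := h
  obtain ⟨n1, n2, n3, n4, n5, n6⟩ := hne
  have inv := hf.invol
  have fx := hfQ x hx
  have ax := hf.adj x fx
  have hy := hQ x hx y h1
  have fy := hfQ y hy
  have ay := hf.adj y fy
  have hz := hQ _ (hQ x hx _ ax) z h2
  have fz := hfQ z hz
  have az := hf.adj z fz
  have hwQ : w ∈ Q := by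
    rcases hw with hw | hw
    · exact hQ y hy w hw
    · exact hQ _ (hQ y hy _ ay) w hw
  have fw := hfQ w hwQ
  have aw := hf.adj w fw
  have hxy := h1.ne
  have hxz := h2.ne
  rcases hw with hw | hw
  · refine hno ⟨[f w, w, y, x, f x, z, f z], [f w, w, y, x, f x, z, f z, f y], ⟨rfl, ?_, ?_⟩,
      le_rfl, ?_, ?_⟩
    · simp; grind
    · simp [aw.symm, hw.symm, h1.symm, ax, h2, az]
    · simp [inv]
    · simp
  · refine hno ⟨[w, f y, y, x, f x, z, f z], [w, f y, y, x, f x, z, f z, f w], ⟨rfl, ?_, ?_⟩,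
      le_rfl, ?_, ?_⟩
    · simp; grind
    · simp [hw.symm, ay.symm, h1.symm, ax, h2, az]
    · simp [inv]
    · simp

/-- Both ends of a matching edge have a further neighbour. If these could never be chosen on
different matching edges, two matching edges would already form a closed set of at most four
vertices. -/
lemma exists_through (hδ : ∀ w x, G.Adj w x → ∃ y, y ≠ x ∧ G.Adj w y) (hf : IsMatch G f)
    {Q : Finset V} (hQ : IsComp G Q) (hfQ : ∀ v ∈ Q, f v ≠ v) (hcard : 7 ≤ Q.card) :
    ∃ x ∈ Q, ∃ y z, Through G f x y z := by
  by_contra! hno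
  obtain ⟨⟨x, hx⟩, hcl, hmin⟩ := hQ
  have inv := hf.invol
  have fx := hfQ x hx
  have ax := hf.adj x fx
  obtain ⟨y, y1, hxy⟩ := hδ x (f x) ax
  obtain ⟨z, z1, hxz⟩ := hδ (f x) x ax.symm
  have hy := hcl x hx y hxy
  have fy := hfQ y hy
  have ay := hf.adj y fy
  have hxyne := hxy.ne
  have hxzne := hxz.ne
  have hz : z = y ∨ z = f y := by
    by_contra! h
    exact hno x hx y z ⟨hxy, hxz, y1, z1, h.1, h.2⟩
  have hclK : IsClosedSet G {x, f x, y, f y} := by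
    intro v hv w hvw
    by_contra hw
    simp only [mem_insert, mem_singleton, not_or] at hw hv
    obtain ⟨w1, w2, w3, w4⟩ := hw
    rcases hv with rfl | rfl | rfl | rfl
    · exact hno v hx w z ⟨hvw, hxz, w2, z1, by grind, by grind⟩
    · exact hno x hx y w ⟨hxy, hvw, y1, w1, w3, w4⟩
    · obtain ⟨r, r1, r2⟩ := hδ (f v) v ay.symm
      have := r2.ne
      by_cases hr : r = x ∨ r = f x
      · exact hno v hy w r ⟨hvw, r2, w4, r1, by grind, by grind⟩
      · exact hno v hy x r ⟨hxy.symm, r2, by grind, r1, by grind, by grind⟩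
    · exact hno y hy x w ⟨hxy.symm, hvw, by grind, w3, w1, w2⟩
  have h1 := card_le_card (hmin _ hclK ⟨x, hx, by simp⟩)
  have h2 : ({x, f x, y, f y} : Finset V).card ≤ 4 := card_le_four
  omega

/-- The booleans mark the visits of a seven-vertex path to the two ends of a central edge. Two
visits meeting every window of three must be at positions 2 and 5, 2 and 4, or 1 and 4. -/
lemma bool_windows : ∀ p0 p1 p2 p3 p4 p5 p6 : Bool,
    [p0, p1, p2, p3, p4, p5, p6].countP id ≤ 2 → (p0 || p1 || p2) → (p1 || p2 || p3) →
    (p2 || p3 || p4) → (p3 || p4 || p5) → (p4 || p5 || p6) →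
    (!p0 && !p1 && p2 && !p3 && !p4 && p5 && !p6) ||
    (!p0 && !p1 && p2 && !p3 && p4 && !p5 && !p6) ||
      (!p0 && p1 && !p2 && !p3 && p4 && !p5 && !p6) := by
  decide

/-- The given path is itself frugal. Away from `x` and `f x` it can only run along a matching edge,
so any three consecutive vertices include `x` or `f x`. The possible positions of these two leave at
most three other matching edges on the path. -/
lemma star_false (hf : IsMatch G f) (hno : ¬ HasFrugalPath G f) {Q : Finset V} {x : V}
    (hleaf : ∀ v ∈ Q, v ≠ x → v ≠ f x → ∀ w, G.Adj v w → w = x ∨ w = f x ∨ w = f v)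
    {l : List V} (hl : IsPath7 G l) (hlQ : ∀ v ∈ l, v ∈ Q) : False := by
  obtain ⟨x', hx'⟩ : ∃ z, f x = z := ⟨_, rfl⟩
  have inv := hf.invol
  have hxx : f x' = x := by rw [← hx', inv]
  rw [hx'] at hleaf
  obtain ⟨P, hP⟩ : ∃ P : V → Bool, ∀ v, P v = true ↔ v = x ∨ v = x' :=
    ⟨fun v => decide (v = x ∨ v = x'), by simp⟩
  have hcount : l.countP P ≤ 2 := by
    rw [List.countP_eq_length_filter, ← List.toFinset_card_of_nodup (hl.nodup.filter _)]
    refine (card_le_card (t := {x, x'}) fun v hv => ?_).trans card_le_two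
    simpa [hP] using (List.mem_filter.1 (List.mem_toFinset.1 hv)).2
  have step : ∀ v ∈ l, ∀ w, G.Adj v w → P v = false → P w = false → w = f v := by
    intro v hv w hvw h1 h2
    rw [← Bool.not_eq_true, hP, not_or] at h1 h2
    have := hleaf v (hlQ v hv) h1.1 h1.2 w hvw
    tauto
  have three : ∀ p ∈ l, ∀ q ∈ l, ∀ r, G.Adj p q → G.Adj q r → p ≠ r → P p || P q || P r := by
    intro p hp q hq r hpq hqr hpr
    by_contra h
    simp only [Bool.or_eq_true, not_or, Bool.not_eq_true] at h
    have e1 := step p hp q hpq h.1.1 h.1.2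
    have e2 := step q hq r hqr h.1.2 h.2
    exact hpr (by rw [e2, e1, inv])
  have fin : ∀ p q r : V, (∀ v ∈ l, P v = true ∨ v ∈ [p, f p, q, f q, r, f r]) → False := by
    intro p q r h
    refine hno ⟨l, [x, x', p, f p, q, f q, r, f r], hl, by simp,
      by simp [inv, hx', hxx], fun v hv => ?_⟩
    have := h v hv
    rw [hP] at this
    simp only [List.mem_cons] at this ⊢
    tauto
  obtain ⟨hlen, hnd, hch⟩ := id hl
  clear hlQ hl hno
  match l, hlen with
  | [a0, a1, a2, a3, a4, a5, a6], _ =>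
    simp only [List.isChain_cons_cons, List.IsChain.singleton, and_true] at hch
    obtain ⟨h0, h1, h2, h3, h4, h5⟩ := hch
    simp only [List.nodup_cons, List.mem_cons, List.not_mem_nil, or_false, not_or] at hnd
    obtain ⟨⟨-, d2, -⟩, ⟨-, e2, -⟩, ⟨-, f2, -⟩, ⟨-, g2, -⟩, ⟨-, k2⟩, -⟩ := hnd
    have key := bool_windows (P a0) (P a1) (P a2) (P a3) (P a4) (P a5) (P a6)
      (by simpa [List.countP_cons] using hcount)
      (three a0 (by simp) a1 (by simp) a2 h0 h1 d2) (three a1 (by simp) a2 (by simp) a3 h1 h2 e2)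
      (three a2 (by simp) a3 (by simp) a4 h2 h3 f2) (three a3 (by simp) a4 (by simp) a5 h3 h4 g2)
      (three a4 (by simp) a5 (by simp) a6 h4 h5 k2)
    simp only [Bool.or_eq_true, Bool.and_eq_true, Bool.not_eq_true'] at key
    have s0 := step a0 (by simp) a1 h0
    have s2 := step a2 (by simp) a3 h2
    have s3 := step a3 (by simp) a4 h3
    have s5 := step a5 (by simp) a6 h5
    rcases key with (k | k) | k
    · refine fin a0 a3 a6 ?_
      have u0 := s0 (by simp [k]) (by simp [k])
      have u3 := s3 (by simp [k]) (by simp [k])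
      simp [k, u0, u3]
    · refine fin a0 a3 a5 ?_
      have u0 := s0 (by simp [k]) (by simp [k])
      have u5 := s5 (by simp [k]) (by simp [k])
      simp [k, u0, u5]
    · refine fin a0 a2 a5 ?_
      have u2 := s2 (by simp [k]) (by simp [k])
      have u5 := s5 (by simp [k]) (by simp [k])
      simp [k, u2, u5]

/-- All edges leaving `{v, f v}` end in `{x, f x}`. -/
def IsPendant (G : SimpleGraph V) (f : V → V) (x v : V) : Prop :=
  ∀ w, G.Adj v w ∨ G.Adj (f v) w → w = x ∨ w = f x ∨ w = v ∨ w = f v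

/-- With `w` in place of `y`, `Through.nbr` confines the edges leaving `{w, f w}` to the matching
edges of `x` and `z`; pendancy of `z` rules out the latter. -/
lemma Through.pendant (hf : IsMatch G f) (hno : ¬ HasFrugalPath G f) {Q : Finset V}
    (hQ : IsClosedSet G Q) (hfQ : ∀ v ∈ Q, f v ≠ v) {x y z : V} (hx : x ∈ Q)
    (h : Through G f x y z) (hz : IsPendant G f x z) {w : V} (hw : G.Adj x w) (hwx : w ≠ f x) :
    IsPendant G f x w := by
  have inv := hf.invol
  have hxw := hw.ne
  by_cases h1 : w = z
  · rwa [h1]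
  by_cases h2 : w = f z
  · subst h2
    intro v hv
    rw [inv] at hv ⊢
    have := hz v hv.symm
    tauto
  have hT : Through G f x w z :=
    ⟨hw, h.2.1, hwx, h.2.2.2.1, Ne.symm h1, fun h => h2 (by rw [h, inv])⟩
  intro v hv
  have c := hT.nbr hf hno hQ hfQ hx hv
  by_contra! hne
  have hv' : v = z ∨ v = f z := by tauto
  have key : ∀ p, G.Adj p v → p = x ∨ p = f x ∨ p = z ∨ p = f z := by
    intro p hp
    apply hz
    rcases hv' with rfl | rfl
    · exact Or.inl hp.symm
    · exact Or.inr hp.symm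
  rcases hv with hv | hv
  · have := key w hv
    grind
  · have := key (f w) hv
    grind

/-- Both `y` and `w` can start the path ending in `z`. The two bounds of `Through.nbr` at `z` have
only the matching edges of `x` and `z` in common. -/
lemma Through.pendant_of_nbr (hf : IsMatch G f) (hno : ¬ HasFrugalPath G f) {Q : Finset V}
    (hQ : IsClosedSet G Q) (hfQ : ∀ v ∈ Q, f v ≠ v) {x y z : V} (hx : x ∈ Q)
    (h : Through G f x y z) {w : V} (hw : G.Adj x w)
    (hw' : w ∉ ({x, f x, y, f y, z, f z} : Finset V)) : IsPendant G f x z := by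
  have inv := hf.invol
  simp only [mem_insert, mem_singleton, not_or] at hw'
  have hT : Through G f x w z :=
    ⟨hw, h.2.1, hw'.2.1, h.2.2.2.1, by tauto, fun h => hw'.2.2.2.2.2 (by rw [h, inv])⟩
  have hfx : f x ∈ Q := hQ x hx _ (hf.adj x (hfQ x hx))
  intro v hv
  have c1 := (h.symm hf).nbr hf hno hQ hfQ hfx hv
  have c2 := (hT.symm hf).nbr hf hno hQ hfQ hfx hv
  rw [inv] at c1 c2
  grind

/-- Pendancy passes from `z` to all neighbours of `x`, and then to those of `f x`. The whole
component therefore consists of matching edges attached to `{x, f x}`, the situation of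
`star_false`. -/
lemma Through.star (hf : IsMatch G f) (hno : ¬ HasFrugalPath G f) {Q : Finset V}
    (hQ : IsComp G Q) (hfQ : ∀ v ∈ Q, f v ≠ v) {x y z : V} (hx : x ∈ Q)
    (h : Through G f x y z) {w : V} (hw : G.Adj x w)
    (hw' : w ∉ ({x, f x, y, f y, z, f z} : Finset V)) {l : List V} (hl : IsPath7 G l)
    (hlQ : ∀ v ∈ l, v ∈ Q) : False := by
  classical
  obtain ⟨-, hcl, hmin⟩ := hQ
  have inv := hf.invol
  have hfx : f x ∈ Q := hcl x hx _ (hf.adj x (hfQ x hx))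
  have hz := h.pendant_of_nbr hf hno hcl hfQ hx hw hw'
  have hpx : ∀ w, G.Adj x w → w ≠ f x → IsPendant G f x w := fun w =>
    h.pendant hf hno hcl hfQ hx hz
  have hflip : ∀ v, IsPendant G f x v ↔ IsPendant G f (f x) v := by
    intro v
    constructor <;>
    · intro hv w hw
      have := hv w hw
      rw [inv] at *
      tauto
  have hpx' : ∀ w, G.Adj (f x) w → w ≠ x → IsPendant G f x w := by
    intro w hw hwx
    rw [hflip]
    exact (h.symm hf).pendant hf hno hcl hfQ hfx ((hflip y).1 (hpx y h.1 h.2.2.1)) hw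
      (by rwa [inv])
  let S : Finset V := univ.filter fun v => v = x ∨ v = f x ∨ IsPendant G f x v
  have hS : ∀ v, v ∈ S ↔ v = x ∨ v = f x ∨ IsPendant G f x v := by simp [S]
  have hclS : IsClosedSet G S := by
    intro v hv w hvw
    rw [hS] at hv ⊢
    rcases hv with rfl | rfl | hv
    · by_cases hwx : w = f v
      · exact Or.inr (Or.inl hwx)
      · exact Or.inr (Or.inr (hpx w hvw hwx))
    · by_cases hwx : w = x
      · exact Or.inl hwx
      · exact Or.inr (Or.inr (hpx' w hvw hwx))
    · rcases hv w (Or.inl hvw) with h | h | h | h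
      · exact Or.inl h
      · exact Or.inr (Or.inl h)
      · exact absurd h hvw.ne'
      · refine Or.inr (Or.inr ?_)
        subst h
        intro u hu
        rw [inv] at hu ⊢
        have := hv u hu.symm
        tauto
  have hQS := hmin S hclS ⟨x, hx, by simp [hS]⟩
  refine star_false (x := x) hf hno ?_ hl hlQ
  intro v hv h1 h2 w hvw
  have h3 := (hS v).1 (hQS hv)
  have h4 : IsPendant G f x v := (h3.resolve_left h1).resolve_left h2
  have h5 := h4 w (Or.inl hvw)
  have := hvw.ne'
  tauto

/-- Three matching edges joined by a passing path cannot exhaust a component of order at least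
seven. By `Through.nbr` an edge leaving them starts at `x` or `f x`, which leads to the star case.
-/
lemma hasFrugalPath (hδ : ∀ w x, G.Adj w x → ∃ y, y ≠ x ∧ G.Adj w y) (hf : IsMatch G f)
    {Q : Finset V} (hQ : IsComp G Q) (hfQ : ∀ v ∈ Q, f v ≠ v)
    {l : List V} (hl : IsPath7 G l) (hlQ : ∀ v ∈ l, v ∈ Q) : HasFrugalPath G f := by
  by_contra hno
  have inv := hf.invol
  have hcard := hl.card_le hlQ
  obtain ⟨x, hx, y, z, hT⟩ := exists_through hδ hf hQ hfQ hcard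
  obtain ⟨-, hcl, hmin⟩ := id hQ
  have hfx : f x ∈ Q := hcl x hx _ (hf.adj x (hfQ x hx))
  have hnot : ¬ IsClosedSet G {x, f x, y, f y, z, f z} := by
    intro h
    have h1 := card_le_card (hmin _ h ⟨x, hx, by simp⟩)
    have h2 : ({x, f x, y, f y, z, f z} : Finset V).card ≤ 6 := card_le_six
    omega
  unfold IsClosedSet at hnot
  push Not at hnot
  obtain ⟨v, hv, w, hvw, hw⟩ := hnot
  have hy : ¬ (G.Adj y w ∨ G.Adj (f y) w) := fun h => hw (by
    have := hT.nbr hf hno hcl hfQ hx h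
    simpa using this)
  have hz : ¬ (G.Adj z w ∨ G.Adj (f z) w) := fun h => hw (by
    have := (hT.symm hf).nbr hf hno hcl hfQ hfx h
    rw [inv] at this
    simp only [mem_insert, mem_singleton]
    tauto)
  simp only [mem_insert, mem_singleton] at hv
  rcases hv with rfl | rfl | rfl | rfl | rfl | rfl
  · exact hT.star hf hno hQ hfQ hx hvw hw hl hlQ
  · refine (hT.symm hf).star hf hno hQ hfQ hfx hvw ?_ hl hlQ
    rw [inv]
    simp only [mem_insert, mem_singleton] at hw ⊢
    tauto
  · exact hy (Or.inl hvw)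
  · exact hy (Or.inr hvw)
  · exact hz (Or.inl hvw)
  · exact hz (Or.inr hvw)

end

/-! ### Components, and the cliques forced by saturation -/

section
variable {V : Type*} {G : SimpleGraph V} {f g : V → V} [DecidableEq V] [Fintype V] {t : ℕ}

lemma IsClosedSet.map_mem {S : Finset V} (hS : IsClosedSet G S) (hf : IsMatch G f) :
    ∀ v ∈ S, f v ∈ S := by
  intro v hv
  by_cases h : f v = v
  · rwa [h]
  · exact hS v hv _ (hf.adj v h)

lemma IsComp.eq_of_mem {S T : Finset V} (hS : IsComp G S) (hT : IsComp G T) {v : V}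
    (h1 : v ∈ S) (h2 : v ∈ T) : S = T :=
  (hS.2.2 T hT.2.1 ⟨v, h1, h2⟩).antisymm (hT.2.2 S hS.2.1 ⟨v, h2, h1⟩)

lemma isComp_filter (C : G.ConnectedComponent)
    [DecidablePred fun v => G.connectedComponentMk v = C] :
    IsComp G (univ.filter fun v => G.connectedComponentMk v = C) := by
  refine ⟨?_, ?_, ?_⟩
  · obtain ⟨v, hv⟩ := C.exists_rep
    exact ⟨v, mem_filter.2 ⟨mem_univ _, hv⟩⟩
  · intro v hv w hvw
    simp only [mem_filter, mem_univ, true_and] at hv ⊢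
    rw [← hv, SimpleGraph.ConnectedComponent.eq]
    exact hvw.symm.reachable
  · rintro T hT ⟨v, hv, hvT⟩ w hw
    simp only [mem_filter, mem_univ, true_and] at hv hw
    obtain ⟨p⟩ := SimpleGraph.ConnectedComponent.eq.1 (hv.trans hw.symm)
    clear hv hw
    induction p with
    | nil => exact hvT
    | cons h _ ih => exact ih (hT _ hvT _ h)

lemma exists_isComp (G : SimpleGraph V) (v : V) : ∃ S, IsComp G S ∧ v ∈ S := by
  classical
  exact ⟨_, isComp_filter (G.connectedComponentMk v), by simp⟩

/-- The vertices of the fan centred at `z`. -/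
lemma IsFan.isComp [DecidableRel G.Adj] {z : V} (h : IsFan G z g) :
    IsComp G (insert z (univ.filter (G.Adj z))) := by
  refine ⟨⟨z, by simp⟩, ?_, ?_⟩
  · intro v hv w hvw
    simp only [mem_insert, mem_filter, mem_univ, true_and] at hv ⊢
    rcases hv with rfl | hv
    · exact Or.inr hvw
    · rcases h.nbr v hv w hvw with h1 | h1
      · exact Or.inl h1
      · exact Or.inr (h1 ▸ h.adj v hv)
  · rintro T hT ⟨v, hv, hvT⟩ w hw
    simp only [mem_insert, mem_filter, mem_univ, true_and] at hv hw
    have hz : z ∈ T := by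
      rcases hv with rfl | hv
      · exact hvT
      · exact hT v hvT z hv.symm
    rcases hw with rfl | hw
    · exact hz
    · exact hT z hz w hw

/-- Any three consecutive path vertices include the centre, but a P_7 has two disjoint triples. -/
lemma IsFan.no_path {z : V} (h : IsFan G z g) {l : List V} (hl : IsPath7 G l)
    (hlz : ∀ v ∈ l, v = z ∨ G.Adj z v) : False := by
  have inv := h.max.1.invol
  obtain ⟨hlen, hnd, hch⟩ := hl
  match l, hlen with
  | [a0, a1, a2, a3, a4, a5, a6], _ =>
    simp only [List.isChain_cons_cons, List.IsChain.singleton, and_true] at hch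
    obtain ⟨h0, h1, h2, h3, h4, h5⟩ := hch
    have three : ∀ p ∈ [a0, a1, a2, a3, a4, a5, a6], ∀ q ∈ [a0, a1, a2, a3, a4, a5, a6], ∀ r,
        G.Adj p q → G.Adj q r → p ≠ r → p = z ∨ q = z ∨ r = z := by
      intro p hp q hq r hpq hqr hpr
      by_contra! hne
      have e1 := h.nbr p ((hlz p hp).resolve_left hne.1) q hpq
      have e2 := h.nbr q ((hlz q hq).resolve_left hne.2.1) r hqr
      have e1' := e1.resolve_left hne.2.1
      have e2' := e2.resolve_left hne.2.2
      exact hpr (by rw [e2', e1', inv])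
    simp only [List.nodup_cons, List.mem_cons, List.not_mem_nil, or_false, not_or] at hnd
    have t0 := three a0 (by simp) a1 (by simp) a2 h0 h1 (by tauto)
    have t3 := three a3 (by simp) a4 (by simp) a5 h3 h4 (by tauto)
    grind

/-- Facts available for a saturated graph with an isolated vertex and no cheap path. -/
structure Setup (G : SimpleGraph V) (t : ℕ) (u : V) : Prop where
  sat : IsCopySat G t
  iso : G.IsIsolated u
  cheap : NoCheap G

variable {u : V}

lemma Setup.closed (h : Setup G t u) : ∀ v w, Missable G v → G.Adj v w → Missable G w :=
  fun _ _ hv hvw => h.sat.missable_of_adj h.cheap h.iso hv hvw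

lemma Setup.not_missable_of_path (h : Setup G t u) {l : List V} (hl : IsPath7 G l) {Q : Finset V}
    (hQ : IsComp G Q) (hlQ : ∀ v ∈ l, v ∈ Q) : ∀ v ∈ Q, ¬ Missable G v := by
  classical
  rintro c hcQ ⟨f, hf, hfc⟩
  have h7 := hl.card_le hlQ
  rcases h.cheap.five_or_fan h.closed hf hfc with ⟨S, hS, hcS⟩ | ⟨z, g, hz, hcz⟩
  · have := card_le_card (hQ.2.2 S hS.2.1 ⟨c, hcQ, hcS⟩)
    have := hS.1
    omega
  · have hQ' := hQ.2.2 _ hz.isComp.2.1 ⟨c, hcQ, by simpa using hcz⟩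
    exact hz.no_path hl fun v hv => by simpa using hQ' (hlQ v hv)

lemma IsMaxMatch.ne_of_not_missable (hf : IsMaxMatch G f) {v : V} (h : ¬ Missable G v) : f v ≠ v :=
  fun h' => h ⟨f, hf, h'⟩

/-- A frugal path spoils at most eight covered vertices, so 2t+8 covered vertices would leave room
for t matching edges. -/
lemma Setup.card_moved_le (h : Setup G t u) {t' : ℕ} (hc : HasCopy G t') (hf : IsMaxMatch G f) :
    (moved f).card ≤ 2 * t + 6 := by
  obtain ⟨l, g, hl, -⟩ := hc
  obtain ⟨v, hv⟩ : ∃ v, v ∈ l := List.exists_mem_of_ne_nil l (by rintro rfl; simpa using hl.len)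
  obtain ⟨Q, hQ, hvQ⟩ := exists_isComp G v
  have hlQ := chain_mem_of_closed hl.chain hQ.2.1 ⟨v, hv, hvQ⟩
  obtain ⟨l', S, hl', h8, hS, hlS⟩ := hasFrugalPath (fun w x => h.sat.minDeg h.iso) hf.1 hQ
    (fun v hv => hf.ne_of_not_missable (h.not_missable_of_path hl hQ hlQ v hv)) hl hlQ
  by_contra hlt
  refine h.sat.free (hasCopy_of_invariant hl' hf.1 S.toFinset (by simpa using hS)
    (by simpa using hlS) ?_)
  have := S.toFinset_card_le
  omega

/-- If `G'` and `G` agree off the closed set `X`, use `f` on `X` and `g` elsewhere. -/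
lemma IsMatch.transfer {G' : SimpleGraph V} {X : Finset V} (hX : IsClosedSet G' X)
    (hGG : ∀ p q, p ∉ X → G'.Adj p q → G.Adj p q) (hg : IsMatch G' g) (hf : IsMatch G f)
    (hfX : ∀ v ∈ X, f v ∈ X) : IsMatch G fun v => if v ∈ X then f v else g v := by
  have hgX := hX.map_mem hg
  have hgX' : ∀ v ∉ X, g v ∉ X := fun v hv h => hv (by simpa [hg.invol] using hgX _ h)
  constructor
  · intro v
    by_cases hv : v ∈ X
    · simp [hv, hfX v hv, hf.invol]
    · simp [hv, hgX' v hv, hg.invol]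
  · intro v
    by_cases hv : v ∈ X
    · simpa [hv] using hf.adj v
    · simp only [hv, if_false]
      exact fun h => hGG _ _ hv (hg.adj v h)

/-- A copy in `G'` disjoint from `X` on the path, where `G'` and `G` agree off `X`, is moved to
`G` by using `f` on `X`. -/
lemma hasCopy_of_transfer {G' : SimpleGraph V} {X : Finset V} (hX : IsClosedSet G' X)
    (hGG : ∀ p q, p ∉ X → G'.Adj p q → G.Adj p q) {l : List V} (hl : IsPath7 G' l)
    (hlX : ∀ v ∈ l, v ∉ X) (hg : IsMatch G' g) (hgl : ∀ v ∈ l, g v = v)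
    (hc : 2 * t ≤ (moved g).card) (hf : IsMatch G f) (hfX : ∀ v ∈ X, f v ∈ X)
    (hle : (X.filter fun v => g v ≠ v).card ≤ (X.filter fun v => f v ≠ v).card) :
    HasCopy G t := by
  refine ⟨l, fun v => if v ∈ X then f v else g v, hl.of_le fun a ha b _ => hGG a b (hlX a ha),
    hg.transfer hX hGG hf hfX, ?_, ?_⟩
  · intro v hv
    simpa [hlX v hv] using hgl v hv
  · have := card_moved_piecewise (f := g) (g := f) X
    omega

/-- The path does not fit into `X`, and `f` misses at most one vertex there, so by parity no
matching of `G'` covers more of `X`. Changes inside `X` are therefore of no help in making a copy.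
-/
lemma not_hasCopy_of_small (hfree : ¬ HasCopy G t) {G' : SimpleGraph V} {X : Finset V}
    (hX : IsClosedSet G' X) (hGG : ∀ p q, p ∉ X → G'.Adj p q → G.Adj p q) (h7 : X.card < 7)
    (hf : IsMatch G f) (hfX : ∀ v ∈ X, f v ∈ X)
    (hcard : X.card ≤ (X.filter fun v => f v ≠ v).card + 1) : ¬ HasCopy G' t := by
  rintro ⟨l, g, hl, hg, hgl, hc⟩
  refine hfree (hasCopy_of_transfer hX hGG hl ?_ hg hgl hc hf hfX ?_)
  · intro v hv hvX
    have := hl.card_le (chain_mem_of_closed hl.chain hX ⟨v, hv, hvX⟩)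
    omega
  · obtain ⟨a, ha⟩ := hf.even_filter hfX
    obtain ⟨b, hb⟩ := hg.even_filter (hX.map_mem hg)
    have := card_filter_le X (fun v => g v ≠ v)
    omega

lemma closed_sup_edge {S : Finset V} (hS : IsClosedSet G S) {x y : V} (hx : x ∈ S) (hy : y ∈ S) :
    IsClosedSet (G ⊔ SimpleGraph.edge x y) S ∧
      ∀ p q, p ∉ S → (G ⊔ SimpleGraph.edge x y).Adj p q → G.Adj p q := by
  constructor
  · intro v hv w hvw
    rw [sup_edge_adj] at hvw
    rcases hvw with h | ⟨⟨-, rfl⟩ | ⟨-, rfl⟩, -⟩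
    · exact hS v hv w h
    · exact hy
    · exact hx
  · intro p q hp hpq
    rw [sup_edge_adj] at hpq
    rcases hpq with h | ⟨⟨rfl, -⟩ | ⟨rfl, -⟩, -⟩
    · exact h
    · exact absurd hx hp
    · exact absurd hy hp

lemma IsFive.complete (hG : IsCopySat G t) {S : Finset V} (hS : IsFive G S) :
    ∀ x ∈ S, ∀ y ∈ S, x ≠ y → G.Adj x y := by
  intro x hx y hy hxy
  by_contra hn
  obtain ⟨h5, hcl, f, hf, h4⟩ := hS
  obtain ⟨h1, h2⟩ := closed_sup_edge hcl hx hy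
  exact not_hasCopy_of_small hG.free h1 h2 (by omega) hf.1 (hcl.map_mem hf.1) (by omega)
    (hG.sat x y hxy hn)

/-- In a copy using a new edge inside `S`, the matching on `S` can be replaced by `f`. If the path
avoids `S`, this gives a copy in `G`. If it lies in `S`, its seven vertices become covered as well,
making a matching larger than `f`. -/
lemma IsCopySat.complete_of_covered (hG : IsCopySat G t) (hf : IsMaxMatch G f)
    (hc : (moved f).card ≤ 2 * t + 6) {S : Finset V} (hS : IsClosedSet G S)
    (hfS : ∀ v ∈ S, f v ≠ v) : ∀ x ∈ S, ∀ y ∈ S, x ≠ y → G.Adj x y := by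
  intro x hx y hy hxy
  by_contra hn
  obtain ⟨h1, h2⟩ := closed_sup_edge hS hx hy
  obtain ⟨l, g, hl, hg, hgl, hgc⟩ := hG.sat x y hxy hn
  have hfS' : S.filter (fun v => f v ≠ v) = S := filter_true_of_mem hfS
  by_cases hlS : ∃ v ∈ l, v ∈ S
  · have h3 := chain_mem_of_closed hl.chain h1 hlS
    have hk := hg.transfer h1 h2 hf.1 (hS.map_mem hf.1)
    have e1 := hf.2 _ hk
    have e2 := card_moved_piecewise (f := g) (g := f) S
    rw [hfS'] at e2
    have e3 : (S.filter fun v => g v ≠ v).card + 7 ≤ S.card := by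
      rw [← hl.len, ← List.toFinset_card_of_nodup hl.nodup, ← card_union_of_disjoint]
      · refine card_le_card (union_subset (filter_subset _ _) fun v hv => h3 v (by simpa using hv))
      · rw [disjoint_left]
        intro v hv hv'
        exact (mem_filter.1 hv).2 (hgl v (by simpa using hv'))
    omega
  · push Not at hlS
    refine hG.free (hasCopy_of_transfer h1 h2 hl hlS hg hgl hgc hf.1 (hS.map_mem hf.1) ?_)
    rw [hfS']
    exact card_filter_le _ _

/-- If `S` had at most five vertices, `S` with `u` would be too small for a P_7 while `f` misses
only `u` in it; joining `u` to `S` would then create no copy. -/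
lemma IsCopySat.six_le_card (hG : IsCopySat G t) {u : V} (hu : G.IsIsolated u) (hf : IsMatch G f)
    {S : Finset V} (hne : S.Nonempty) (hS : IsClosedSet G S) (hfS : ∀ v ∈ S, f v ≠ v) :
    6 ≤ S.card := by
  by_contra hlt
  obtain ⟨x, hx⟩ := hne
  have hfu : f u = u := by
    by_contra h; exact hu _ (hf.adj u h)
  have huS : u ∉ S := fun h => hfS u h hfu
  have hux : u ≠ x := by rintro rfl; exact huS hx
  have hfS' : S.filter (fun v => f v ≠ v) = S := filter_true_of_mem hfS
  obtain ⟨k, hk⟩ := hf.even_filter (hS.map_mem hf)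
  rw [hfS'] at hk
  have hcl : IsClosedSet G (insert u S) := by
    intro v hv w hvw
    rcases mem_insert.1 hv with rfl | hv
    · exact absurd hvw (hu _)
    · exact mem_insert_of_mem (hS v hv w hvw)
  obtain ⟨h1, h2⟩ := closed_sup_edge hcl (mem_insert_self u S) (mem_insert_of_mem hx)
  have hcard := card_insert_of_notMem huS
  refine not_hasCopy_of_small hG.free h1 h2 (by omega) hf (hcl.map_mem hf) ?_
    (hG.sat u x hux (hu x))
  rw [filter_insert, if_neg (by simpa using hfu), hfS', hcard]

end

/-! ### Classification of components and the degree count -/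

section
variable {V : Type*} {G : SimpleGraph V} {f g : V → V} [DecidableEq V] [Fintype V] {t : ℕ} {u : V}
  [DecidableRel G.Adj]

/-- All vertices of `S` are pairwise adjacent. -/
def IsCompleteOn (G : SimpleGraph V) (S : Finset V) : Prop := ∀ x ∈ S, ∀ y ∈ S, x ≠ y → G.Adj x y

/-- `S` is the vertex set of a fan with at least one blade which does not have five vertices. -/
def IsFanComp (G : SimpleGraph V) [DecidableRel G.Adj] (S : Finset V) : Prop :=
  ∃ z g, IsFan G z g ∧ S = insert z (univ.filter (G.Adj z)) ∧ (∃ v, G.Adj z v) ∧ S.card ≠ 5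

lemma IsFan.even_card {z : V} (h : IsFan G z g) : Even (univ.filter (G.Adj z)).card := by
  have h1 := h.max.1.even_filter (S := univ.filter (G.Adj z)) (by simpa using h.adj)
  rwa [filter_true_of_mem] at h1
  intro v hv hgv
  exact h.max.not_adj h.fix hgv (by simpa using hv)

lemma IsFan.isFive_of_card {z : V} (h : IsFan G z g)
    (h5 : (insert z (univ.filter (G.Adj z))).card = 5) :
    IsFive G (insert z (univ.filter (G.Adj z))) := by
  refine ⟨h5, h.isComp.2.1, g, h.max, ?_⟩
  rw [card_insert_of_notMem (by simp)] at h5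
  rw [filter_insert, if_neg (by simpa using h.fix), filter_true_of_mem]
  · omega
  · intro v hv hgv
    exact h.max.not_adj h.fix hgv (by simpa using hv)

/-- The components of `G`. -/
lemma Setup.classify (h : Setup G t u) (hf : IsMaxMatch G f) (hc : (moved f).card ≤ 2 * t + 6)
    {S : Finset V} (hS : IsComp G S) :
    (∃ v, S = {v} ∧ G.IsIsolated v) ∨ (S.card = 5 ∧ IsCompleteOn G S) ∨ IsFanComp G S ∨
      (IsCompleteOn G S ∧ 6 ≤ S.card ∧ Even S.card ∧ ∀ v ∈ S, f v ≠ v) := by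
  by_cases hm : ∃ v ∈ S, Missable G v
  · obtain ⟨c, hcS, k, hk, hkc⟩ := hm
    rcases h.cheap.five_or_fan h.closed hk hkc with ⟨T, hT, hcT⟩ | ⟨z, g, hz, hcz⟩
    · have hTc := hT.complete h.sat
      have hST : S = T := by
        refine (hS.2.2 T hT.2.1 ⟨c, hcS, hcT⟩).antisymm fun v hv => ?_
        by_cases hvc : c = v
        · rwa [← hvc]
        · exact hS.2.1 c hcS v (hTc c hcT v hv hvc)
      subst hST
      exact Or.inr (Or.inl ⟨hT.1, hTc⟩)
    · have hSz := hS.eq_of_mem hz.isComp hcS (by simpa using hcz)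
      by_cases hN : ∃ v, G.Adj z v
      -- A fan of order five satisfies `IsFive` and so falls under the complete case.
      · by_cases h5 : S.card = 5
        · have := hz.isFive_of_card (hSz ▸ h5)
          rw [← hSz] at this
          exact Or.inr (Or.inl ⟨h5, this.complete h.sat⟩)
        · exact Or.inr (Or.inr (Or.inl ⟨z, g, hz, hSz, hN, h5⟩))
      · push Not at hN
        refine Or.inl ⟨z, ?_, hN⟩
        rw [hSz, filter_false_of_mem fun v _ => hN v]
        rfl
  · push Not at hm
    have hcov : ∀ v ∈ S, f v ≠ v := fun v hv => hf.ne_of_not_missable (hm v hv)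
    refine Or.inr (Or.inr (Or.inr ⟨h.sat.complete_of_covered hf hc hS.2.1 hcov,
      h.sat.six_le_card h.iso hf.1 hS.1 hS.2.1 hcov, ?_, hcov⟩))
    have := hf.1.even_filter (hS.2.1.map_mem hf.1)
    rwa [filter_true_of_mem hcov] at this

lemma sum_degree_of_complete {S : Finset V} (hS : IsClosedSet G S) (hc : IsCompleteOn G S) :
    ∑ v ∈ S, G.degree v = S.card * (S.card - 1) := by
  rw [sum_const_nat]
  intro v hv
  rw [← SimpleGraph.card_neighborFinset_eq_degree, ← card_erase_of_mem hv]
  congr 1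
  ext w
  simp only [SimpleGraph.mem_neighborFinset, mem_erase]
  exact ⟨fun h => ⟨h.ne', hS v hv w h⟩, fun h => hc v hv w h.2 h.1.symm⟩

lemma IsFan.sum_degree {z : V} (h : IsFan G z g) :
    ∑ v ∈ insert z (univ.filter (G.Adj z)), G.degree v = 3 * (univ.filter (G.Adj z)).card := by
  have hz : G.degree z = (univ.filter (G.Adj z)).card := by
    rw [← SimpleGraph.card_neighborFinset_eq_degree]
    congr 1
    ext w; simp
  rw [sum_insert (by simp), hz, sum_const_nat (m := 2)]
  · ring
  · intro v hv
    have hzv : G.Adj z v := by simpa using hv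
    have hgv : g v ≠ v := fun h' => h.max.not_adj h.fix h' hzv
    rw [← SimpleGraph.card_neighborFinset_eq_degree]
    have : G.neighborFinset v = {z, g v} := by
      ext w
      simp only [SimpleGraph.mem_neighborFinset, mem_insert, mem_singleton]
      refine ⟨h.nbr v hzv w, ?_⟩
      rintro (rfl | rfl)
      · exact hzv.symm
      · exact h.max.1.adj v hgv
    rw [this, card_pair (h.adj v hzv).ne]

lemma IsFanComp.weight {S : Finset V} (hS : IsFanComp G S) (hf : IsMatch G f) :
    3 * (S.filter fun v => f v ≠ v).card ≤ ∑ v ∈ S, G.degree v := by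
  obtain ⟨z, g, hz, rfl, -, -⟩ := hS
  rw [hz.sum_degree]
  -- A fan has odd order, so an even number of covered vertices is at most the degree of the centre.
  obtain ⟨a, ha⟩ := hf.even_filter (hz.isComp.2.1.map_mem hf)
  obtain ⟨b, hb⟩ := hz.even_card
  have h1 := card_filter_le (insert z (univ.filter (G.Adj z))) (fun v => f v ≠ v)
  rw [card_insert_of_notMem (by simp)] at h1
  omega

/-- The excess of the degree sum of `S` over three times the number of covered vertices. -/
def weight (G : SimpleGraph V) [DecidableRel G.Adj] (f : V → V) (S : Finset V) : ℤ :=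
  ∑ v ∈ S, ((G.degree v : ℤ) - if f v ≠ v then 3 else 0)

lemma weight_eq (S : Finset V) : weight G f S =
    ((∑ v ∈ S, G.degree v : ℕ) : ℤ) - 3 * ((S.filter fun v => f v ≠ v).card : ℤ) := by
  rw [weight, sum_sub_distrib, ← sum_filter, sum_const]
  push_cast
  simp
  ring

lemma weight_univ [Fintype G.ConnectedComponent] [DecidableEq G.ConnectedComponent] :
    ∑ C : G.ConnectedComponent,
    weight G f (univ.filter fun v => G.connectedComponentMk v = C) =
      ((∑ v, G.degree v : ℕ) : ℤ) - 3 * ((moved f).card : ℤ) := by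
  rw [moved, ← weight_eq]
  exact sum_fiberwise _ _ _

/-- The components partition the vertices and none has negative weight, so any two of them weigh at
most the total. -/
lemma weight_add_le (hw : ∀ S, IsComp G S → 0 ≤ weight G f S) {S T : Finset V} (hS : IsComp G S)
    (hT : IsComp G T) (hne : S ≠ T) : weight G f S + weight G f T ≤
      ((∑ v, G.degree v : ℕ) : ℤ) - 3 * ((moved f).card : ℤ) := by
  classical
  have key : ∀ S, IsComp G S → ∃ C : G.ConnectedComponent,
      S = univ.filter fun v => G.connectedComponentMk v = C := by
    intro S hS
    obtain ⟨v, hv⟩ := hS.1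
    exact ⟨G.connectedComponentMk v, hS.eq_of_mem (isComp_filter _) hv (by simp)⟩
  obtain ⟨C, rfl⟩ := key S hS
  obtain ⟨D, rfl⟩ := key T hT
  have hCD : C ≠ D := by rintro rfl; exact hne rfl
  rw [← weight_univ, ← sum_pair (f := fun C => weight G f
    (univ.filter fun v => G.connectedComponentMk v = C)) hCD]
  exact sum_le_sum_of_subset_of_nonneg (subset_univ _) fun C _ _ => hw _ (isComp_filter C)

lemma weight_le (hw : ∀ S, IsComp G S → 0 ≤ weight G f S) {S : Finset V} (hS : IsComp G S) :
    weight G f S ≤ ((∑ v, G.degree v : ℕ) : ℤ) - 3 * ((moved f).card : ℤ) := by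
  classical
  obtain ⟨v, hv⟩ := hS.1
  rw [hS.eq_of_mem (isComp_filter (G.connectedComponentMk v)) hv (by simp), ← weight_univ]
  exact single_le_sum (f := fun C => weight G f
    (univ.filter fun v => G.connectedComponentMk v = C)) (fun C _ => hw _ (isComp_filter C))
    (mem_univ _)

/-- The structure of a sparse saturated graph without cheap paths. -/
lemma Setup.structure (h : Setup G t u) (hf : IsMaxMatch G f) (hN : 2 * t + 6 ≤ (moved f).card)
    {t' : ℕ} (hc : HasCopy G t') (he : ∑ v, G.degree v ≤ 6 * t + 50) :
    (moved f).card = 2 * t + 6 ∧ ∑ v, G.degree v = 6 * t + 50 ∧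
      ∃ Q, IsComp G Q ∧ Q.card = 8 ∧ IsCompleteOn G Q ∧ (∀ v ∈ Q, f v ≠ v) ∧
        ∀ S, IsComp G S → S ≠ Q → (∃ v, S = {v} ∧ G.IsIsolated v) ∨ IsFanComp G S := by
  have hN' := h.card_moved_le hc hf
  have hcl := fun S (hS : IsComp G S) => h.classify hf hN' hS
  -- s(s-1) - 3s = s(s-4).
  have hbig : ∀ S : Finset V, IsComp G S → IsCompleteOn G S → (∀ v ∈ S, f v ≠ v) →
      6 ≤ S.card → weight G f S = S.card * (S.card - 4) := by
    intro S hS h1 h2 h3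
    rw [weight_eq, sum_degree_of_complete hS.2.1 h1, filter_true_of_mem h2]
    push_cast [show 1 ≤ S.card by omega]
    ring
  -- The degree sum is 20, and by parity at most four of the five vertices are covered.
  have hfive : ∀ S : Finset V, IsComp G S → S.card = 5 → IsCompleteOn G S → 8 ≤ weight G f S := by
    intro S hS h5 h1
    rw [weight_eq, sum_degree_of_complete hS.2.1 h1]
    obtain ⟨a, ha⟩ := hf.1.even_filter (hS.2.1.map_mem hf.1)
    have := card_filter_le S (fun v => f v ≠ v)
    rw [h5] at this ⊢
    omega
  have hw : ∀ S, IsComp G S → 0 ≤ weight G f S := by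
    intro S hS
    rcases hcl S hS with ⟨v, rfl, hv⟩ | ⟨h5, h1⟩ | h1 | ⟨h1, h2, -, h3⟩
    · have hfv : f v = v := by
        by_contra h'; exact hv _ (hf.1.adj v h')
      simp [weight, hfv]
    · linarith [hfive S hS h5 h1]
    · rw [weight_eq]
      have := h1.weight hf.1
      push_cast
      zify at this
      linarith
    · rw [hbig S hS h1 h3 h2]
      have : (6 : ℤ) ≤ S.card := by exact_mod_cast h2
      nlinarith
  obtain ⟨l, g, hl, -⟩ := hc
  obtain ⟨v, hv⟩ : ∃ v, v ∈ l := List.exists_mem_of_ne_nil l (by rintro rfl; simpa using hl.len)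
  obtain ⟨Q, hQ, hvQ⟩ := exists_isComp G v
  have hlQ := chain_mem_of_closed hl.chain hQ.2.1 ⟨v, hv, hvQ⟩
  have h7 := hl.card_le hlQ
  have hQf : ∀ v ∈ Q, f v ≠ v :=
    fun v hv => hf.ne_of_not_missable (h.not_missable_of_path hl hQ hlQ v hv)
  have hQc := h.sat.complete_of_covered hf hN' hQ.2.1 hQf
  have h8 : 8 ≤ Q.card := by
    obtain ⟨a, ha⟩ := hf.1.even_filter (hQ.2.1.map_mem hf.1)
    rw [filter_true_of_mem hQf] at ha
    omega
  have hwQ := hbig Q hQ hQc hQf (by omega)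
  have hle := weight_le hw hQ
  have h8' : (8 : ℤ) ≤ Q.card := by exact_mod_cast h8
  -- 6t + 50 - 3(2t + 6) = 32 = 8(8 - 4), so a clique of order at least eight has order exactly
  -- eight and leaves no weight for other components.
  have hub : ((∑ v, G.degree v : ℕ) : ℤ) - 3 * ((moved f).card : ℤ) ≤ 32 := by
    omega
  have hQ8 : (Q.card : ℤ) = 8 := by nlinarith
  have hwQ32 : weight G f Q = 32 := by rw [hwQ, hQ8]; norm_num
  refine ⟨by omega, by omega, Q, hQ, by exact_mod_cast hQ8, hQc, hQf, ?_⟩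
  intro S hS hSQ
  have h0 := weight_add_le hw hQ hS hSQ.symm
  rcases hcl S hS with h1 | ⟨h5, h1⟩ | h1 | ⟨h1, h2, -, h3⟩
  · exact Or.inl h1
  · have := hfive S hS h5 h1
    linarith
  · exact Or.inr h1
  · have := hbig S hS h1 h3 h2
    have h6 : (6 : ℤ) ≤ S.card := by exact_mod_cast h2
    nlinarith

end

/-! ### Excluding matching number t + 2 -/

section
variable {V : Type*} {G : SimpleGraph V} {f g h : V → V} [DecidableEq V] [Fintype V] {t : ℕ} {u : V}

/-- Shift the hole of a maximum matching to a vertex missed by another one. -/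
lemma IsMaxMatch.flip (hf : IsMaxMatch G f) (n : ℕ) : ∀ (h : V → V) (z : V), IsMaxMatch G h →
    h z = z → (univ.filter fun v => f v ≠ h v).card = n →
    ∃ k, IsMaxMatch G k ∧ k z = z ∧ (∃ w, ∀ v, f v = v → v ≠ w → k v = v) ∧
      ∀ v, f v = h v → f v ≠ v → k v = f v := by
  induction n using Nat.strong_induction_on with
  | _ n ih =>
  intro h z hh hz hn
  have inv := hf.1.invol
  have inv' := hh.1.invol
  by_cases hfz : f z = z
  · exact ⟨f, hf, hfz, ⟨z, fun v hv _ => hv⟩, fun v _ _ => rfl⟩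
  obtain ⟨z1, hz1⟩ : ∃ a, f z = a := ⟨_, rfl⟩
  have fz1 : f z1 = z := by rw [← hz1, inv]
  have e1 : G.Adj z z1 := hz1 ▸ hf.1.adj z hfz
  replace hfz : z1 ≠ z := by rwa [hz1] at hfz
  have c1 : h z1 ≠ z1 := fun h' => hh.not_adj hz h' e1
  obtain ⟨z2, hz2⟩ : ∃ a, h z1 = a := ⟨_, rfl⟩
  have hz2' : h z2 = z1 := by rw [← hz2, inv']
  have e2 : G.Adj z1 z2 := hz2 ▸ hh.1.adj z1 c1
  rw [hz2] at c1
  have n2 : z2 ≠ z := by grind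
  by_cases hf2 : f z2 = z2
  · obtain ⟨k, k1, k2, k3, k4, k5⟩ := hf.switch (x := z1) hf2 (by rw [fz1]; exact hfz.symm) e2.symm
    rw [fz1] at k4 k5
    refine ⟨k, k1, k4, ⟨z2, fun v hv hv2 => ?_⟩, fun v hv hv2 => ?_⟩
    · rw [k5, hv] <;> grind
    · rw [k5] <;> grind
  -- The exchanged matching `r` pairs `z` with `z1` as `f` does, so it disagrees with `f` at fewer
  -- vertices, and its hole is `z2`. Induction brings the hole to `z2`; one more exchange returns it
  -- to `z`.
  · obtain ⟨r, r1, r2, r3, r4, r5⟩ := hh.switch (x := z1) hz (by rwa [hz2]) e1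
    rw [hz2] at r4 r5
    have hlt : (univ.filter fun v => f v ≠ r v).card < n := by
      rw [← hn]
      refine card_lt_card ⟨fun v hv => ?_, fun hsub => ?_⟩
      · simp only [mem_filter, mem_univ, true_and] at hv ⊢
        by_cases v1 : v = z
        · subst v1; rw [hz, hz1]; exact hfz
        by_cases v2 : v = z1
        · subst v2; exact absurd (fz1.trans r3.symm) hv
        by_cases v3 : v = z2
        · subst v3
          rw [hz2']
          intro h'
          exact n2 (by rw [← inv v, h', fz1])
        rwa [← r5 v v1 v2 v3]
      · have : z ∈ univ.filter fun v => f v ≠ r v := hsub (by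
          simp only [mem_filter, mem_univ, true_and]
          rw [hz, hz1]; exact hfz)
        simp only [mem_filter, mem_univ, true_and] at this
        exact this (by rw [r2, hz1])
    obtain ⟨k, k1, k2, ⟨w, k3⟩, k4⟩ := ih _ hlt r z2 r1 r4 rfl
    have kz1 : k z1 = z := by rw [k4, fz1] <;> grind
    have kz : k z = z1 := by rw [← kz1, k1.1.invol]
    obtain ⟨s, s1, s2, s3, s4, s5⟩ := k1.switch (x := z1) k2 (by rw [kz1]; exact hfz.symm) e2.symm
    rw [kz1] at s4 s5
    refine ⟨s, s1, s4, ⟨w, fun v hv hvw => ?_⟩, fun v hv hv2 => ?_⟩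
    · rw [s5, k3 v hv hvw] <;> grind
    · have v1 : v ≠ z := by rintro rfl; exact hv2 (hv.trans hz)
      have v2 : v ≠ z1 := by rintro rfl; exact n2 (by rw [← hz2, ← hv, fz1])
      have v3 : v ≠ z2 := by
        rintro rfl
        exact n2 (by rw [← inv v, hv, hz2', fz1])
      rw [s5 v v3 v2 v1, k4 v (by rw [r5 v v1 v2 v3]; exact hv) hv2]

/-- For a matching number as small as possible, nonadjacent vertices are missed together. -/
lemma IsCopySat.exists_missing_pair (hG : IsCopySat G t) (hf : IsMaxMatch G f)
    (hN : (moved f).card = 2 * t + 4) {x y : V} (hxy : x ≠ y) (hn : ¬ G.Adj x y) :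
    ∃ g, IsMaxMatch G g ∧ g x = x ∧ g y = y := by
  obtain ⟨k, hk, hkc⟩ := (hG.sat x y hxy hn).exists_isMatch
  by_cases hkx : k x = y
  · have hky : k y = x := by rw [← hkx, hk.invol]
    obtain ⟨g, g1, g2, g3, g4⟩ := hk.clear {x, y} (by simp [hkx, hky])
    have hg : IsMatch G g := by
      refine ⟨g1.invol, fun v hv => ?_⟩
      have hv' : v ∉ ({x, y} : Finset V) := fun h => hv (g2 v h)
      have := g1.adj v hv
      rw [sup_edge_adj] at this
      simp only [mem_insert, mem_singleton] at hv'
      tauto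
    -- `k` covers at least 2t+6 vertices, so dropping the edge `xy` leaves the maximum 2t+4.
    refine ⟨g, ⟨hg, fun r hr => ?_⟩, g2 x (by simp), g2 y (by simp)⟩
    have h1 := hf.2 r hr
    have h2 := card_filter_le ({x, y} : Finset V) (fun v => k v ≠ v)
    have h3 := card_le_two (a := x) (b := y)
    omega
  · have hk' : IsMatch G k := by
      refine ⟨hk.invol, fun v hv => ?_⟩
      have := hk.adj v hv
      rw [sup_edge_adj] at this
      rcases this with h | ⟨⟨rfl, h⟩ | ⟨rfl, h⟩, -⟩
      · exact h
      · exact absurd h hkx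
      · exact absurd (by rw [← h, hk.invol]) hkx
    have := hf.2 k hk'
    omega

lemma IsCopySat.missable (hG : IsCopySat G t) (hu : G.IsIsolated u) (hf : IsMaxMatch G f)
    (hN : (moved f).card = 2 * t + 4) (x : V) : Missable G x := by
  by_cases hux : u = x
  · subst hux
    refine ⟨f, hf, ?_⟩
    by_contra h
    exact hu _ (hf.1.adj u h)
  · obtain ⟨g, g1, -, g2⟩ := hG.exists_missing_pair hf hN hux (hu x)
    exact ⟨g, g1, g2⟩

/-- This is the argument of Gallai's lemma. If `x` and `y` were nonadjacent, some `g` would miss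
both. Moving a hole to `z` disturbs at most one of the missed vertices, so `z` and one of its
neighbours `x`, `y` would be missed together. -/
lemma IsCopySat.adj_trans (hG : IsCopySat G t) (hu : G.IsIsolated u) (hf : IsMaxMatch G f)
    (hN : (moved f).card = 2 * t + 4) {x y z : V} (hxz : G.Adj x z) (hzy : G.Adj z y)
    (hxy : x ≠ y) : G.Adj x y := by
  by_contra hn
  obtain ⟨g, g1, gx, gy⟩ := hG.exists_missing_pair hf hN hxy hn
  obtain ⟨h, h1, hz⟩ := hG.missable hu hf hN z
  obtain ⟨k, k1, k2, ⟨w, k3⟩, -⟩ := g1.flip _ h z h1 hz rfl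
  by_cases hw : x = w
  · exact k1.not_adj k2 (k3 y gy (fun h => hxy (hw.trans h.symm))) hzy
  · exact k1.not_adj (k3 x gx hw) k2 hxz

/-- By `IsCopySat.adj_trans` the components are cliques, and since every vertex is missable their
orders are odd. The weight bound then allows only one component with a P_7, namely a K_7, and
joining `u` to it creates no copy. -/
lemma IsCopySat.card_moved_ne (hG : IsCopySat G t) (hu : G.IsIsolated u) [DecidableRel G.Adj]
    (hf : IsMaxMatch G f) {t' : ℕ} (hc : HasCopy G t') (he : ∑ v, G.degree v ≤ 6 * t + 50) :
    (moved f).card ≠ 2 * t + 4 := by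
  intro hN
  have hcomp : ∀ S, IsComp G S → IsCompleteOn G S := by
    intro S hS x hx y hy hxy
    have hcl : IsClosedSet G (insert x (univ.filter (G.Adj x))) := by
      intro v hv w hvw
      simp only [mem_insert, mem_filter, mem_univ, true_and] at hv ⊢
      rcases hv with rfl | hv
      · exact Or.inr hvw
      · by_cases hwx : w = x
        · exact Or.inl hwx
        · exact Or.inr (hG.adj_trans hu hf hN hv hvw (Ne.symm hwx))
    have := hS.2.2 _ hcl ⟨x, hx, by simp⟩ hy
    simp only [mem_insert, mem_filter, mem_univ, true_and] at this
    exact this.resolve_left hxy.symm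
  have herase : ∀ S, IsComp G S → ∀ g, IsMaxMatch G g → ∀ x ∈ S, g x = x →
      S.filter (fun v => g v ≠ v) = S.erase x := by
    intro S hS g hg x hx hgx
    ext v
    simp only [mem_filter, mem_erase]
    constructor
    · rintro ⟨h1, h2⟩
      exact ⟨by rintro rfl; exact h2 hgx, h1⟩
    · rintro ⟨h1, h2⟩
      exact ⟨h2, fun h => hg.not_adj hgx h (hcomp S hS x hx v h2 h1.symm)⟩
  have hodd : ∀ S, IsComp G S → Odd S.card := by
    intro S hS
    obtain ⟨x, hx⟩ := hS.1
    obtain ⟨g, hg, hgx⟩ := hG.missable hu hf hN x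
    obtain ⟨a, ha⟩ := hg.1.even_filter (hS.2.1.map_mem hg.1)
    rw [herase S hS g hg x hx hgx, card_erase_of_mem hx] at ha
    have := card_pos.2 hS.1
    exact ⟨a, by omega⟩
  -- At most s-1 vertices of an odd clique K_s are covered: s(s-1) - 3(s-1) = (s-1)(s-3).
  have hwt : ∀ S, IsComp G S → ((S.card : ℤ) - 1) * (S.card - 3) ≤ weight G f S := by
    intro S hS
    rw [weight_eq, sum_degree_of_complete hS.2.1 (hcomp S hS)]
    obtain ⟨a, ha⟩ := hf.1.even_filter (hS.2.1.map_mem hf.1)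
    obtain ⟨b, hb⟩ := hodd S hS
    have h1 := card_filter_le S (fun v => f v ≠ v)
    have h2 : (S.filter fun v => f v ≠ v).card ≤ S.card - 1 := by omega
    have h3 : 1 ≤ S.card := by omega
    zify [h3] at h2
    push_cast [h3]
    linarith
  have hw : ∀ S, IsComp G S → 0 ≤ weight G f S := by
    intro S hS
    refine le_trans ?_ (hwt S hS)
    obtain ⟨b, hb⟩ := hodd S hS
    rw [hb]
    push_cast
    rcases Nat.eq_zero_or_pos b with rfl | hb
    · norm_num
    · have : (1 : ℤ) ≤ b := by exact_mod_cast hb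
      nlinarith
  -- 6t + 50 - 3(2t + 4) = 38. A K_9 and two copies of K_7 both weigh 48.
  have hub : ((∑ v, G.degree v : ℕ) : ℤ) - 3 * ((moved f).card : ℤ) ≤ 38 := by omega
  have hpath : ∀ l, IsPath7 G l → ∃ Q, IsComp G Q ∧ (∀ v ∈ l, v ∈ Q) ∧ Q.card = 7 ∧
      24 ≤ weight G f Q := by
    intro l hl
    obtain ⟨v, hv⟩ : ∃ v, v ∈ l := List.exists_mem_of_ne_nil l (by rintro rfl; simpa using hl.len)
    obtain ⟨Q, hQ, hvQ⟩ := exists_isComp G v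
    have hlQ := chain_mem_of_closed hl.chain hQ.2.1 ⟨v, hv, hvQ⟩
    have h7 := hl.card_le hlQ
    have hle := (hwt Q hQ).trans ((weight_le hw hQ).trans hub)
    obtain ⟨b, hb⟩ := hodd Q hQ
    have hb3 : (3 : ℤ) ≤ b := by omega
    have hb4 : (b : ℤ) < 4 := by
      rw [hb] at hle
      push_cast at hle
      nlinarith
    have hQ7 : Q.card = 7 := by omega
    have := hwt Q hQ
    rw [hQ7] at this
    exact ⟨Q, hQ, hlQ, hQ7, by norm_num at this; linarith⟩
  obtain ⟨l0, -, hl0, -⟩ := hc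
  obtain ⟨Q, hQ, -, hQ7, hwQ⟩ := hpath l0 hl0
  obtain ⟨x, hx⟩ := hQ.1
  have hfQ : 6 ≤ (Q.filter fun v => f v ≠ v).card := by
    by_cases h : ∃ y ∈ Q, f y = y
    · obtain ⟨y, hy, hfy⟩ := h
      rw [herase Q hQ f hf y hy hfy, card_erase_of_mem hy, hQ7]
    · push Not at h
      rw [filter_true_of_mem h, hQ7]
      norm_num
  have huQ : u ∉ Q := by
    intro h
    have h1 := card_le_card (hQ.2.2 {u} (by
      intro v hv w hvw
      rw [mem_singleton] at hv
      subst hv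
      exact absurd hvw (hu _)) ⟨u, h, by simp⟩)
    rw [card_singleton] at h1
    omega
  have hux : u ≠ x := by rintro rfl; exact huQ hx
  have hcl : IsClosedSet G (insert u Q) := by
    intro v hv w hvw
    rcases mem_insert.1 hv with rfl | hv
    · exact absurd hvw (hu _)
    · exact mem_insert_of_mem (hQ.2.1 v hv w hvw)
  obtain ⟨h1, h2⟩ := closed_sup_edge hcl (mem_insert_self u Q) (mem_insert_of_mem hx)
  obtain ⟨l, g, hl, hg, hgl, hgc⟩ := hG.sat u x hux (hu x)
  have hX8 : (insert u Q).card = 8 := by rw [card_insert_of_notMem huQ, hQ7]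
  by_cases hlX : ∃ v ∈ l, v ∈ insert u Q
  · have h3 := chain_mem_of_closed hl.chain h1 hlX
    have e1 := hf.2 _ (hg.transfer h1 h2 hf.1 (hcl.map_mem hf.1))
    have e2 := card_moved_piecewise (f := g) (g := f) (insert u Q)
    have e3 : ((insert u Q).filter fun v => g v ≠ v).card + 7 ≤ (insert u Q).card := by
      rw [← hl.len, ← List.toFinset_card_of_nodup hl.nodup, ← card_union_of_disjoint]
      · exact card_le_card (union_subset (filter_subset _ _) fun v hv => h3 v (by simpa using hv))
      · rw [disjoint_left]
        intro v hv hv'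
        exact (mem_filter.1 hv).2 (hgl v (by simpa using hv'))
    -- The path takes seven of the eight vertices, so by parity `g` covers none of them. Using `f`
    -- there adds six covered vertices to the 2t of `g`, exceeding 2t+4.
    obtain ⟨a, ha⟩ := hg.even_filter (h1.map_mem hg)
    have e4 : (Q.filter fun v => f v ≠ v).card ≤ ((insert u Q).filter fun v => f v ≠ v).card :=
      card_le_card (filter_subset_filter _ (subset_insert _ _))
    omega
  · push Not at hlX
    obtain ⟨Q2, hQ2, hlQ2, -, hwQ2⟩ := hpath l (hl.of_le fun a ha b _ => h2 a b (hlX a ha))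
    have hne : Q ≠ Q2 := by
      rintro rfl
      obtain ⟨v, hv⟩ : ∃ v, v ∈ l := List.exists_mem_of_ne_nil l (by rintro rfl; simpa using hl.len)
      exact hlX v hv (mem_insert_of_mem (hlQ2 v hv))
    have := (weight_add_le hw hQ hQ2 hne).trans hub
    linarith

end

/-! ### From components to graph embeddings and matching numbers -/

section
variable {V W W' : Type*} {G : SimpleGraph V} {f g h : V → V}

/-- The range of a graph embedding is closed under adjacency. -/
def IsClosedEmb {H : SimpleGraph W} (φ : H ↪g G) : Prop :=
  ∀ a v, G.Adj (φ a) v → v ∈ Set.range φ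

/-- Disjoint closed ranges have no edges between them, so the combined map also reflects adjacency.
Closedness is passed on to allow iteration. -/
lemma exists_sum_embedding {H : SimpleGraph W} {H' : SimpleGraph W'} (φ : H ↪g G) (ψ : H' ↪g G)
    (hφ : IsClosedEmb φ) (hψ : IsClosedEmb ψ) (hd : ∀ a b, φ a ≠ ψ b) :
    ∃ χ : (H ⊕g H') ↪g G, IsClosedEmb χ ∧ Set.range χ = Set.range φ ∪ Set.range ψ := by
  have hna : ∀ a b, ¬ G.Adj (φ a) (ψ b) := by
    intro a b h
    obtain ⟨c, hc⟩ := hφ a _ h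
    exact hd c b hc
  have hr : Set.range (Sum.elim φ ψ) = Set.range φ ∪ Set.range ψ := Set.Sum.elim_range _ _
  refine ⟨⟨⟨Sum.elim φ ψ, ?_⟩, ?_⟩, ?_, hr⟩
  · exact Function.Injective.sumElim φ.injective ψ.injective hd
  · rintro (a | a) (b | b)
    · simp
    · simpa using hna a b
    · simpa using fun h => hna b a h.symm
    · simp
  · rintro (a | a) v hv
    · exact hr ▸ Or.inl (hφ a v hv)
    · exact hr ▸ Or.inr (hψ a v hv)

lemma exists_disjointUnion_embedding {ι : Type*} {U : ι → Type*} {H : ∀ i, SimpleGraph (U i)}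
    (φ : ∀ i, H i ↪g G) (hφ : ∀ i, IsClosedEmb (φ i)) (hd : ∀ i j a b, φ i a = φ j b → i = j) :
    ∃ χ : disjointUnion H ↪g G, IsClosedEmb χ ∧ Set.range χ = ⋃ i, Set.range (φ i) := by
  have hr : Set.range (fun p : Σ i, U i => φ p.1 p.2) = ⋃ i, Set.range (φ i) := by
    ext v
    simp
  refine ⟨⟨⟨fun p => φ p.1 p.2, ?_⟩, ?_⟩, ?_, hr⟩
  · rintro ⟨i, a⟩ ⟨j, b⟩ h
    obtain rfl := hd i j a b h
    obtain rfl := (φ i).injective h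
    rfl
  · rintro ⟨i, a⟩ ⟨j, b⟩
    constructor
    · intro h
      obtain ⟨c, hc⟩ := hφ i a _ h
      obtain rfl := hd i j c b hc
      exact ⟨i, a, b, (φ i).map_adj_iff.1 h, rfl, rfl⟩
    · rintro ⟨k, a', b', h, h1, h2⟩
      rw [h1, h2]
      exact (φ k).map_adj_iff.2 h
  · rintro ⟨i, a⟩ v hv
    exact hr ▸ Set.mem_iUnion.2 ⟨i, hφ i a v hv⟩

lemma isClosedEmb_of_range {H : SimpleGraph W} {φ : H ↪g G} {S : Finset V}
    (hS : IsClosedSet G S) (h : Set.range φ = S) : IsClosedEmb φ := by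
  intro a v hv
  rw [h]
  exact hS _ (by have : φ a ∈ (S : Set V) := h ▸ Set.mem_range_self a
                 exact this) v hv

lemma exists_complete_embedding {S : Finset V} {k : ℕ} (hc : ∀ x ∈ S, ∀ y ∈ S, x ≠ y → G.Adj x y)
    (hk : S.card = k) :
    ∃ φ : SimpleGraph.completeGraph (Fin k) ↪g G, Set.range φ = S := by
  let e := S.equivFinOfCardEq hk
  refine ⟨⟨⟨fun i => (e.symm i : V), fun i j h => e.symm.injective (Subtype.ext h)⟩, ?_⟩, ?_⟩
  · intro i j
    simp only [SimpleGraph.completeGraph_eq_top, SimpleGraph.top_adj]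
    constructor
    · rintro h rfl
      exact G.irrefl h
    · intro hij
      exact hc _ (e.symm i).2 _ (e.symm j).2 fun h => hij (e.symm.injective (Subtype.ext h))
  · ext v
    simp only [Set.mem_range, SetLike.mem_coe]
    constructor
    · rintro ⟨i, rfl⟩
      exact (e.symm i).2
    · intro hv
      exact ⟨e ⟨v, hv⟩, congrArg Subtype.val (e.symm_apply_apply ⟨v, hv⟩)⟩

lemma exists_empty_embedding {S : Finset V} {k : ℕ} (hc : ∀ x ∈ S, G.IsIsolated x)
    (hk : S.card = k) :
    ∃ φ : SimpleGraph.emptyGraph (Fin k) ↪g G, Set.range φ = S := by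
  let e := S.equivFinOfCardEq hk
  refine ⟨⟨⟨fun i => (e.symm i : V), fun i j h => e.symm.injective (Subtype.ext h)⟩, ?_⟩, ?_⟩
  · intro i j
    simp only [SimpleGraph.emptyGraph_eq_bot, SimpleGraph.bot_adj, iff_false]
    exact hc _ (e.symm i).2 _
  · ext v
    simp only [Set.mem_range, SetLike.mem_coe]
    constructor
    · rintro ⟨i, rfl⟩
      exact (e.symm i).2
    · intro hv
      exact ⟨e ⟨v, hv⟩, congrArg Subtype.val (e.symm_apply_apply ⟨v, hv⟩)⟩

lemma IsFan.exists_embedding [LinearOrder V] [Fintype V] [DecidableRel G.Adj] {z : V}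
    (hz : IsFan G z g) :
    ∃ φ : fan ((univ.filter (G.Adj z)).card / 2) ↪g G,
      Set.range φ = (insert z (univ.filter (G.Adj z)) : Finset V) := by
  have inv := hz.max.1.invol
  have hne : ∀ v, G.Adj z v → g v ≠ v := fun v hv hgv => hz.max.not_adj hz.fix hgv hv
  -- Each blade is represented by its smaller vertex.
  let A : Finset V := univ.filter fun v => G.Adj z v ∧ v < g v
  have hA : ∀ v, v ∈ A ↔ G.Adj z v ∧ v < g v := by simp [A]
  have hcard : A.card = (univ.filter (G.Adj z)).card / 2 := by
    have h1 : univ.filter (G.Adj z) = A ∪ A.image g := by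
      ext v
      simp only [mem_filter, mem_univ, true_and, mem_union, hA, mem_image]
      constructor
      · intro hv
        rcases lt_or_gt_of_ne (hne v hv) with h | h
        · exact Or.inr ⟨g v, ⟨hz.adj v hv, by rwa [inv]⟩, inv v⟩
        · exact Or.inl ⟨hv, h⟩
      · rintro (h | ⟨w, h, rfl⟩)
        · exact h.1
        · exact hz.adj w h.1
    have h2 : Disjoint A (A.image g) := by
      rw [disjoint_left]
      intro v hv hv'
      obtain ⟨w, hw, rfl⟩ := mem_image.1 hv'
      rw [hA] at hv hw
      rw [inv] at hv
      exact hv.2.asymm hw.2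
    rw [h1, card_union_of_disjoint h2, card_image_of_injective _ fun a b => hz.max.1.inj]
    omega
  let e := A.equivFinOfCardEq hcard
  have he : ∀ i, G.Adj z (e.symm i) ∧ ((e.symm i : V) < g (e.symm i)) :=
    fun i => (hA _).1 (e.symm i).2
  have einj : ∀ i j, (e.symm i : V) = e.symm j → i = j :=
    fun i j h => e.symm.injective (Subtype.ext h)
  have ecross : ∀ i j, (e.symm i : V) ≠ g (e.symm j) := by
    intro i j h
    have h1 := (he i).2
    rw [h, inv] at h1
    exact h1.asymm (he j).2
  let φ : Option (Fin ((univ.filter (G.Adj z)).card / 2) × Bool) → V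
    | none => z
    | some (j, false) => e.symm j
    | some (j, true) => g (e.symm j)
  have hφz : ∀ p, G.Adj z (φ (some p)) := by
    rintro ⟨j, b⟩
    cases b
    · exact (he j).1
    · exact hz.adj _ (he j).1
  have hφg : ∀ j b, g (φ (some (j, b))) = φ (some (j, !b)) := by
    intro j b
    cases b
    · rfl
    · exact inv _
  have hφi : ∀ p q, φ (some p) = φ (some q) → p = q := by
    rintro ⟨i, b⟩ ⟨j, c⟩ h
    cases b <;> cases c
    · rw [einj i j h]
    · exact absurd h (ecross i j)
    · exact absurd h.symm (ecross j i)
    · rw [einj i j (hz.max.1.inj h)]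
  refine ⟨⟨⟨φ, ?_⟩, ?_⟩, ?_⟩
  · rintro (_ | p) (_ | q) h
    · rfl
    · exact absurd h (hφz q).ne
    · exact absurd h (hφz p).ne'
    · rw [hφi p q h]
  · rintro (_ | ⟨i, b⟩) (_ | ⟨j, c⟩)
    · exact iff_of_false (G.irrefl) id
    · exact iff_of_true (hφz _) trivial
    · exact iff_of_true (hφz _).symm trivial
    · change G.Adj (φ (some (i, b))) (φ (some (j, c))) ↔ i = j ∧ b ≠ c
      constructor
      · intro h
        rcases hz.nbr _ (hφz _) _ h with h1 | h1
        · exact absurd h1 (hφz _).ne'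
        · rw [hφg] at h1
          have := hφi _ _ h1
          simp only [Prod.mk.injEq] at this
          refine ⟨this.1.symm, ?_⟩
          rw [this.2]
          cases b <;> simp
      · rintro ⟨rfl, hbc⟩
        have : c = !b := by revert hbc; cases b <;> cases c <;> simp
        rw [this, ← hφg]
        exact hz.max.1.adj _ (hne _ (hφz _))
  · ext v
    simp only [coe_insert, coe_filter, mem_univ, true_and, Set.mem_insert_iff, Set.mem_ofPred_eq]
    constructor
    · rintro ⟨_ | p, rfl⟩
      · exact Or.inl rfl
      · exact Or.inr (hφz p)
    · rintro (rfl | hv)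
      · exact ⟨none, rfl⟩
      · rcases lt_or_gt_of_ne (hne v hv) with h | h
        · have hm : g v ∈ A := (hA _).2 ⟨hz.adj v hv, by rwa [inv]⟩
          refine ⟨some (e ⟨g v, hm⟩, true), ?_⟩
          change g (e.symm (e ⟨g v, hm⟩)) = v
          rw [Equiv.symm_apply_apply, inv]
        · have hm : v ∈ A := (hA _).2 ⟨hv, h⟩
          refine ⟨some (e ⟨v, hm⟩, false), ?_⟩
          change ((e.symm (e ⟨v, hm⟩) : A) : V) = v
          rw [Equiv.symm_apply_apply]

variable [Fintype V] [DecidableEq V]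

lemma two_mul_ncard_edgeSet {M : G.Subgraph} (hf : ∀ v, f (f v) = v)
    (hM : ∀ a b, M.Adj a b ↔ f a = b ∧ a ≠ b) : 2 * M.edgeSet.ncard = (moved f).card := by
  have hE : M.edgeSet = ((moved f).image fun v => s(v, f v) : Finset (Sym2 V)) := by
    ext e
    induction e using Sym2.ind with
    | _ a b =>
      rw [SimpleGraph.Subgraph.mem_edgeSet, hM]
      simp only [coe_image, Set.mem_image, SetLike.mem_coe, mem_moved, Sym2.eq_iff]
      constructor
      · rintro ⟨rfl, h⟩
        exact ⟨a, h.symm, Or.inl ⟨rfl, rfl⟩⟩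
      · rintro ⟨v, hv, ⟨rfl, rfl⟩ | ⟨rfl, rfl⟩⟩
        · exact ⟨rfl, hv.symm⟩
        · exact ⟨hf _, hv⟩
  rw [hE, Set.ncard_coe_finset, card_eq_sum_card_image (fun v => s(v, f v)) (moved f),
    sum_const_nat (m := 2), mul_comm]
  intro e he
  obtain ⟨v, hv, rfl⟩ := mem_image.1 he
  rw [mem_moved] at hv
  rw [← card_pair hv.symm]
  congr 1
  ext w
  simp only [mem_filter, mem_moved, Sym2.eq_iff, mem_insert, mem_singleton]
  constructor
  · rintro ⟨-, h | h⟩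
    · exact Or.inl h.1
    · exact Or.inr h.1
  · rintro (rfl | rfl)
    · exact ⟨hv, Or.inl ⟨rfl, rfl⟩⟩
    · exact ⟨by rw [hf]; exact hv.symm, Or.inr ⟨rfl, hf v⟩⟩

lemma two_mul_matchingNumber (hf : IsMaxMatch G f) : 2 * matchingNumber G = (moved f).card := by
  classical
  let M : G.Subgraph :=
    { verts := {v | f v ≠ v}
      Adj := fun a b => f a = b ∧ a ≠ b
      adj_sub := by
        rintro a b ⟨rfl, h⟩
        exact hf.1.adj a h.symm
      edge_vert := by
        rintro a b ⟨rfl, h⟩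
        exact h.symm
      symm := ⟨by
        rintro a b ⟨rfl, h⟩
        exact ⟨hf.1.invol a, h.symm⟩⟩ }
  have hM : M.IsMatching := by
    intro v hv
    exact ⟨f v, ⟨rfl, Ne.symm hv⟩, fun w hw => hw.1.symm⟩
  have hMc : 2 * M.edgeSet.ncard = (moved f).card :=
    two_mul_ncard_edgeSet hf.1.invol fun _ _ => Iff.rfl
  -- An attained maximum also bounds the set, so `sSup` is its true value and not the default 0.
  have hmax : IsGreatest {m : ℕ | ∃ M : G.Subgraph, M.IsMatching ∧ M.edgeSet.ncard = m}
      M.edgeSet.ncard := by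
    refine ⟨⟨M, hM, rfl⟩, ?_⟩
    rintro m ⟨M', hM', rfl⟩
    let k : V → V := fun v => if hv : v ∈ M'.verts then (hM' hv).choose else v
    have hk : ∀ v (hv : v ∈ M'.verts), M'.Adj v (k v) ∧ ∀ w, M'.Adj v w → w = k v := by
      intro v hv
      have : k v = (hM' hv).choose := dif_pos hv
      rw [this]
      exact (hM' hv).choose_spec
    have hk' : ∀ v, v ∉ M'.verts → k v = v := fun v hv => dif_neg hv
    have hadj : ∀ a b, M'.Adj a b ↔ k a = b ∧ a ≠ b := by
      intro a b
      constructor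
      · intro h
        exact ⟨((hk a (M'.edge_vert h)).2 b h).symm, h.ne⟩
      · rintro ⟨rfl, h⟩
        by_cases ha : a ∈ M'.verts
        · exact (hk a ha).1
        · exact absurd (hk' a ha).symm h
    have hinv : ∀ v, k (k v) = v := by
      intro v
      by_cases hv : v ∈ M'.verts
      · exact ((hadj _ _).1 (hk v hv).1.symm).1
      · rw [hk' v hv, hk' v hv]
    have hkm : IsMatch G k := ⟨hinv, fun v hv => M'.adj_sub ((hadj _ _).2 ⟨rfl, hv.symm⟩)⟩
    have h1 := hf.2 k hkm
    have h2 := two_mul_ncard_edgeSet hinv hadj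
    omega
  rw [matchingNumber, hmax.csSup_eq, hMc]

/-- A maximum matching restricts to a maximum matching of a union of components. -/
lemma IsMaxMatch.comap [Fintype W] [DecidableEq W] {H : SimpleGraph W} (hf : IsMaxMatch G f)
    (φ : H ↪g G) (hφ : IsClosedEmb φ) : ∃ k, IsMaxMatch H k ∧
      (moved k).card = ((univ.image φ).filter fun v => f v ≠ v).card := by
  have hmem : ∀ a, ∃ b, φ b = f (φ a) := by
    intro a
    by_cases h : f (φ a) = φ a
    · exact ⟨a, h.symm⟩
    · exact hφ a _ (hf.1.adj _ h)
  choose k hk using hmem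
  have hcard : ∀ (h : W → W) (h' : V → V), (∀ a, φ (h a) = h' (φ a)) →
      (moved h).card = ((univ.image φ).filter fun v => h' v ≠ v).card := by
    intro h h' hh
    rw [← card_image_of_injective (moved h) φ.injective]
    congr 1
    ext v
    simp only [mem_image, mem_moved, mem_filter, mem_univ, true_and]
    constructor
    · rintro ⟨a, ha, rfl⟩
      exact ⟨⟨a, rfl⟩, by rw [← hh]; exact fun h => ha (φ.injective h)⟩
    · rintro ⟨⟨a, rfl⟩, ha⟩
      exact ⟨a, fun h => ha (by rw [← hh, h]), rfl⟩
  refine ⟨k, ⟨⟨fun v => φ.injective ?_, fun v hv => ?_⟩, fun h hh => ?_⟩, hcard k f hk⟩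
  · rw [hk, hk, hf.1.invol]
  · rw [← φ.map_adj_iff, hk]
    exact hf.1.adj _ fun h => hv (φ.injective ((hk v).trans h))
  -- A matching of `H` is carried into `G` and pasted into `f` on the range of `φ`; maximality of
  -- `f` bounds it.
  · let H' : V → V := Function.extend φ (φ ∘ h) id
    have h1 : ∀ a, H' (φ a) = φ (h a) := fun a => φ.injective.extend_apply _ _ a
    have h2 : ∀ v, (¬ ∃ a, φ a = v) → H' v = v := fun v hv => Function.extend_apply' _ _ _ hv
    have hH : IsMatch G H' := by
      constructor
      · intro v
        by_cases hv : ∃ a, φ a = v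
        · obtain ⟨a, rfl⟩ := hv
          rw [h1, h1, hh.invol]
        · rw [h2 v hv, h2 v hv]
      · intro v hv
        by_cases hv' : ∃ a, φ a = v
        · obtain ⟨a, rfl⟩ := hv'
          rw [h1] at hv ⊢
          exact φ.map_adj_iff.2 (hh.adj a fun h => hv (by rw [h]))
        · exact absurd (h2 v hv') hv
    have hcl : ∀ k : V → V, IsMatch G k → ∀ v ∈ univ.image φ, k v ∈ univ.image φ := by
      intro k hk v hv
      obtain ⟨a, -, rfl⟩ := mem_image.1 hv
      by_cases h : k (φ a) = φ a
      · rwa [h]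
      · obtain ⟨b, hb⟩ := hφ a _ (hk.adj _ h)
        exact mem_image.2 ⟨b, mem_univ _, hb⟩
    have e1 := hf.2 _ (hf.1.piecewise hH (univ.image φ) (hcl f hf.1) (hcl H' hH))
    have e2 := card_moved_piecewise (f := f) (g := H') (univ.image φ)
    rw [hcard h H' fun a => (h1 a).symm, hcard k f hk]
    omega

end

lemma IsSaturated.isCopySat {n t : ℕ} {G : SimpleGraph (Fin n)}
    (h : IsSaturated (pathPlusMatching 7 t) G) : IsCopySat G t :=
  ⟨fun h' => h.1 (isContained_of_hasCopy h'),
    fun u v huv hn => hasCopy_of_isContained (h.2 u v ⟨huv, hn⟩)⟩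

/-! ### Assembling the isomorphism -/

section
variable {V : Type*} {G : SimpleGraph V} {f : V → V} [LinearOrder V] [Fintype V]
  [DecidableRel G.Adj] {t : ℕ} {Q : Finset V}

lemma IsFanComp.isComp {S : Finset V} (h : IsFanComp G S) : IsComp G S := by
  obtain ⟨z, g, hz, rfl, -⟩ := h
  exact hz.isComp

lemma IsFanComp.exists_embedding {S : Finset V} (h : IsFanComp G S) :
    ∃ φ : fan ((S.card - 1) / 2) ↪g G, Set.range φ = S := by
  obtain ⟨z, g, hz, rfl, -⟩ := h
  rw [card_insert_of_notMem (by simp), Nat.add_sub_cancel]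
  exact hz.exists_embedding

lemma IsFanComp.card {S : Finset V} (h : IsFanComp G S) :
    S.card = 3 ∨ (7 ≤ S.card ∧ Odd S.card) := by
  obtain ⟨z, g, hz, rfl, ⟨v, hv⟩, h5⟩ := h
  obtain ⟨a, ha⟩ := hz.even_card
  have : 0 < (univ.filter (G.Adj z)).card := card_pos.2 ⟨v, by simpa using hv⟩
  rw [card_insert_of_notMem (by simp)] at h5 ⊢
  by_cases h1 : a = 1
  · exact Or.inl (by omega)
  · exact Or.inr ⟨by omega, ⟨a, by omega⟩⟩

lemma IsFanComp.complete {S : Finset V} (h : IsFanComp G S) (h3 : S.card = 3) :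
    IsCompleteOn G S := by
  obtain ⟨z, g, hz, rfl, ⟨v, hv⟩, -⟩ := h
  rw [card_insert_of_notMem (by simp)] at h3
  have hgv : g v ≠ v := fun h => hz.max.not_adj hz.fix h hv
  have hN : univ.filter (G.Adj z) = {v, g v} := by
    symm
    apply eq_of_subset_of_card_le
    · intro w hw
      simp only [mem_insert, mem_singleton] at hw
      rcases hw with rfl | rfl
      · simpa using hv
      · simpa using hz.adj v hv
    · rw [card_pair hgv.symm]; omega
  rw [hN]
  have h1 := hz.adj v hv
  have h2 := hz.max.1.adj v hgv
  intro x hx y hy hxy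
  simp only [mem_insert, mem_singleton] at hx hy
  rcases hx with rfl | rfl | rfl <;> rcases hy with rfl | rfl | rfl <;>
    first | exact absurd rfl hxy | assumption | (apply SimpleGraph.Adj.symm; assumption)

/-- Assemble the isomorphism from the list of components. -/
lemma exists_iso (hf : IsMaxMatch G f) (hQ : IsComp G Q) (hQ8 : Q.card = 8)
    (hQc : IsCompleteOn G Q) (hQf : ∀ v ∈ Q, f v ≠ v)
    (hrest : ∀ S, IsComp G S → S ≠ Q → (∃ v, S = {v} ∧ G.IsIsolated v) ∨ IsFanComp G S) :
    ∃ (c k : ℕ) (s : Fin k → ℕ) (m : ℕ), (∀ j, 7 ≤ 2 * s j + 1) ∧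
      2 * matchingNumber (copies c (SimpleGraph.completeGraph (Fin 3)) ⊕g fans s) + 8 =
        (moved f).card ∧
      Nonempty (G ≃g ((SimpleGraph.completeGraph (Fin 8) ⊕g
        (copies c (SimpleGraph.completeGraph (Fin 3)) ⊕g fans s)) ⊕g
          SimpleGraph.emptyGraph (Fin m))) := by
  classical
  -- Fans have odd order.
  have hQfan : ¬ IsFanComp G Q := by
    intro h
    obtain h | h := h.card
    · omega
    · rw [hQ8] at h
      exact absurd h.2 (by decide)
  -- Fans of order three are the triangles; all others have order at least seven.
  let T := {S : Finset V // IsFanComp G S ∧ S.card = 3}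
  let F := {S : Finset V // IsFanComp G S ∧ S.card ≠ 3}
  let eT := (Fintype.equivFin T).symm
  let eF := (Fintype.equivFin F).symm
  have hT : ∀ i : Fin (Fintype.card T), ∃ φ : SimpleGraph.completeGraph (Fin 3) ↪g G,
      Set.range φ = (eT i : Finset V) := fun i =>
    exists_complete_embedding ((eT i).2.1.complete (eT i).2.2) (eT i).2.2
  choose φT hφT using hT
  have hF : ∀ i : Fin (Fintype.card F), ∃ φ : fan (((eF i : Finset V).card - 1) / 2) ↪g G,
      Set.range φ = (eF i : Finset V) := fun i => (eF i).2.1.exists_embedding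
  choose φF hφF using hF
  obtain ⟨φI, hφI⟩ := exists_empty_embedding (G := G) (S := univ.filter fun v => G.IsIsolated v)
    (by simp) rfl
  obtain ⟨φQ, hφQ⟩ := exists_complete_embedding hQc hQ8
  have hmemT : ∀ i a, φT i a ∈ (eT i : Finset V) := fun i a => by
    have : φT i a ∈ ((eT i : Finset V) : Set V) := hφT i ▸ Set.mem_range_self a
    exact this
  have hmemF : ∀ i a, φF i a ∈ (eF i : Finset V) := fun i a => by
    have : φF i a ∈ ((eF i : Finset V) : Set V) := hφF i ▸ Set.mem_range_self a
    exact this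
  obtain ⟨χT, cT, rT⟩ := exists_disjointUnion_embedding φT
    (fun i => isClosedEmb_of_range (eT i).2.1.isComp.2.1 (hφT i)) (by
      intro i j a b hab
      have := (eT i).2.1.isComp.eq_of_mem (eT j).2.1.isComp (hmemT i a) (hab ▸ hmemT j b)
      exact eT.injective (Subtype.ext this))
  obtain ⟨χF, cF, rF⟩ := exists_disjointUnion_embedding φF
    (fun i => isClosedEmb_of_range (eF i).2.1.isComp.2.1 (hφF i)) (by
      intro i j a b hab
      have := (eF i).2.1.isComp.eq_of_mem (eF j).2.1.isComp (hmemF i a) (hab ▸ hmemF j b)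
      exact eF.injective (Subtype.ext this))
  have mT : ∀ v, v ∈ Set.range χT ↔ ∃ S, IsFanComp G S ∧ S.card = 3 ∧ v ∈ S := by
    intro v
    rw [rT, Set.mem_iUnion]
    constructor
    · rintro ⟨i, hi⟩
      rw [hφT] at hi
      exact ⟨eT i, (eT i).2.1, (eT i).2.2, hi⟩
    · rintro ⟨S, h1, h2, h3⟩
      refine ⟨eT.symm ⟨S, h1, h2⟩, ?_⟩
      rw [hφT, Equiv.apply_symm_apply]
      exact h3
  have mF : ∀ v, v ∈ Set.range χF ↔ ∃ S, IsFanComp G S ∧ S.card ≠ 3 ∧ v ∈ S := by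
    intro v
    rw [rF, Set.mem_iUnion]
    constructor
    · rintro ⟨i, hi⟩
      rw [hφF] at hi
      exact ⟨eF i, (eF i).2.1, (eF i).2.2, hi⟩
    · rintro ⟨S, h1, h2, h3⟩
      refine ⟨eF.symm ⟨S, h1, h2⟩, ?_⟩
      rw [hφF, Equiv.apply_symm_apply]
      exact h3
  obtain ⟨χK, cK, rK⟩ := exists_sum_embedding χT χF cT cF (by
    intro a b hab
    obtain ⟨S, h1, h2, h3⟩ := (mT _).1 (Set.mem_range_self a)
    obtain ⟨S', h1', h2', h3'⟩ := (mF _).1 (Set.mem_range_self b)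
    have := h1.isComp.eq_of_mem h1'.isComp h3 (hab ▸ h3')
    exact h2' (this ▸ h2))
  have mK : ∀ v, v ∈ Set.range χK ↔ ∃ S, IsFanComp G S ∧ v ∈ S := by
    intro v
    rw [rK, Set.mem_union, mT, mF]
    constructor
    · rintro (⟨S, h1, -, h3⟩ | ⟨S, h1, -, h3⟩) <;> exact ⟨S, h1, h3⟩
    · rintro ⟨S, h1, h3⟩
      by_cases h : S.card = 3
      · exact Or.inl ⟨S, h1, h, h3⟩
      · exact Or.inr ⟨S, h1, h, h3⟩
  have cQ : IsClosedEmb φQ := isClosedEmb_of_range hQ.2.1 hφQ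
  have mQ : ∀ v, v ∈ Set.range φQ ↔ v ∈ Q := by simp [hφQ]
  obtain ⟨χ, cχ, rχ⟩ := exists_sum_embedding φQ χK cQ cK (by
    intro a b hab
    have h1 := (mQ _).1 (Set.mem_range_self a)
    obtain ⟨S, h2, h3⟩ := (mK _).1 (Set.mem_range_self b)
    exact hQfan (hQ.eq_of_mem h2.isComp h1 (hab ▸ h3) ▸ h2))
  have mI : ∀ v, v ∈ Set.range φI ↔ G.IsIsolated v := by simp [hφI]
  have hnI : ∀ S, IsComp G S → 2 ≤ S.card → ∀ v ∈ S, ¬ G.IsIsolated v := by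
    intro S hS h2 v hv hvi
    have := card_le_card (hS.2.2 {v} (by
      intro w hw x hwx
      rw [mem_singleton] at hw
      subst hw
      exact absurd hwx (hvi _)) ⟨v, hv, by simp⟩)
    rw [card_singleton] at this
    omega
  have hfan2 : ∀ S, IsFanComp G S → 2 ≤ S.card := fun S hS => by
    rcases hS.card with h | h <;> omega
  obtain ⟨ψ, -, rψ⟩ := exists_sum_embedding χ φI cχ (by
      intro a v hv
      exact absurd hv ((mI _).1 (Set.mem_range_self a) v)) (by
    intro a b hab
    have h1 := (mI _).1 (Set.mem_range_self b)
    have h2 : χ a ∈ Set.range χ := Set.mem_range_self a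
    rw [hab, rχ, Set.mem_union, mQ, mK] at h2
    rcases h2 with h2 | ⟨S, h2, h3⟩
    · exact hnI Q hQ (by omega) _ h2 h1
    · exact hnI S h2.isComp (hfan2 S h2) _ h3 h1)
  have cover : ∀ v, v ∈ Q ∨ (∃ S, IsFanComp G S ∧ v ∈ S) ∨ G.IsIsolated v := by
    intro v
    obtain ⟨S, hS, hv⟩ := exists_isComp G v
    by_cases hSQ : S = Q
    · exact Or.inl (hSQ ▸ hv)
    rcases hrest S hS hSQ with ⟨w, rfl, hw⟩ | h
    · rw [mem_singleton] at hv
      exact Or.inr (Or.inr (hv ▸ hw))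
    · exact Or.inr (Or.inl ⟨S, h, hv⟩)
  have hsurj : Function.Surjective ψ := by
    intro v
    change v ∈ Set.range ψ
    rw [rψ, rχ, Set.mem_union, Set.mem_union, mQ, mK, mI]
    exact or_assoc.2 (cover v)
  obtain ⟨k, hk, hkc⟩ := hf.comap χK cK
  refine ⟨_, _, _, _, ?_, ?_, ⟨(RelIso.ofSurjective ψ hsurj).symm⟩⟩
  · intro j
    have h1 := (eF j).2.2
    rcases (eF j).2.1.card with h | ⟨h, a, ha⟩
    · exact absurd h h1
    · omega
  -- Isolated vertices are uncovered, so the covered vertices are the eight of `Q` and those in the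
  -- triangles and fans.
  · rw [show 2 * matchingNumber (copies (Fintype.card T) (SimpleGraph.completeGraph (Fin 3)) ⊕g
      fans fun i => ((eF i : Finset V).card - 1) / 2) = (moved k).card from
        two_mul_matchingNumber hk, hkc, ← hQ8, ← card_union_of_disjoint]
    · congr 1
      ext v
      simp only [mem_union, mem_filter, mem_moved]
      have hmem : v ∈ univ.image χK ↔ ∃ S, IsFanComp G S ∧ v ∈ S := by
        rw [← mK]; simp
      rw [hmem]
      constructor
      · rintro (h | h)
        · exact h.2
        · exact hQf v h
      · intro h
        rcases cover v with h1 | h1 | h1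
        · exact Or.inr h1
        · exact Or.inl ⟨h1, h⟩
        · exact absurd (hf.1.adj v h) (h1 _)
    · rw [disjoint_left]
      intro v hv hvQ
      have hmem : v ∈ Set.range χK := by
        simpa using (mem_filter.1 hv).1
      obtain ⟨S, h2, h3⟩ := (mK v).1 hmem
      exact hQfan (hQ.eq_of_mem h2.isComp hvQ h3 ▸ h2)

end

end LinearForestSat

theorem mainTheorem2 (t : ℕ) (ht : 1 ≤ t) :
    ∃ N : ℕ, ∀ n : ℕ, N ≤ n → ∀ G : SimpleGraph (Fin n),
      LinearForestSat.IsSaturated (LinearForestSat.pathPlusMatching 7 t) G →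
      2 ≤ {v : Fin n | G.IsIsolated v}.ncard →
      G.edgeSet.ncard ≤ 3 * t + 25 →
      G.edgeSet.ncard = 3 * t + 25 ∧
      ∃ (c k : ℕ) (s : Fin k → ℕ) (m : ℕ),
        -- every fan has order at least 7
        (∀ j, 7 ≤ Fintype.card (Option (Fin (s j) × Bool))) ∧
        LinearForestSat.matchingNumber
          (LinearForestSat.copies c (SimpleGraph.completeGraph (Fin 3)) ⊕g
            LinearForestSat.fans s) = t - 1 ∧
        -- the number of isolated vertices is `n - 3c - |F| - 8`
        8 + 3 * c + Fintype.card (Σ j : Fin k, Option (Fin (s j) × Bool)) + m = n ∧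
        Nonempty (G ≃g
          ((SimpleGraph.completeGraph (Fin 8) ⊕g
            (LinearForestSat.copies c (SimpleGraph.completeGraph (Fin 3)) ⊕g
              LinearForestSat.fans s)) ⊕g
            SimpleGraph.emptyGraph (Fin m))) := by
  classical
  -- The degree count is uniform in `n`, so the threshold 0 serves.
  refine ⟨0, fun n _ G hsat hiso he => ?_⟩
  have hG := hsat.isCopySat
  obtain ⟨u, v, hu, hv, huv⟩ := (Set.one_lt_ncard_iff (Set.toFinite _)).1 hiso
  have hc := hG.hasCopy_pred huv hu hv
  have hdeg : ∑ v, G.degree v = 2 * G.edgeSet.ncard := by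
    rw [G.sum_degrees_eq_twice_card_edges, Set.ncard_eq_toFinset_card', SimpleGraph.edgeFinset]
  obtain ⟨f, hf⟩ := LinearForestSat.exists_isMaxMatch G
  obtain ⟨g, hg, hgc⟩ := hc.exists_isMatch
  have h1 := hf.2 g hg
  have h2 := hG.card_moved_ne hu hf hc (by omega)
  -- The number of covered vertices is even, at least 2(t-1)+6 = 2t+4, and different from 2t+4.
  have h3 : 2 * t + 6 ≤ (LinearForestSat.moved f).card := by
    obtain ⟨a, ha⟩ := hf.1.even_moved
    omega
  have hS : LinearForestSat.Setup G t u := ⟨hG, hu, hG.noCheap ⟨f, hf.1, h3⟩⟩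
  obtain ⟨h4, h5, Q, hQ, hQ8, hQc, hQf, hrest⟩ := hS.structure hf h3 hc (by omega)
  obtain ⟨c, k, s, m, hs, hm, ⟨e⟩⟩ := LinearForestSat.exists_iso hf hQ hQ8 hQc hQf hrest
  refine ⟨by omega, c, k, s, m, fun j => ?_, by omega, ?_, ⟨e⟩⟩
  · have := hs j
    simp only [Fintype.card_option, Fintype.card_prod, Fintype.card_fin, Fintype.card_bool]
    omega
  · have := Fintype.card_congr e.toEquiv
    simp only [Fintype.card_sum, Fintype.card_fin, Fintype.card_sigma, Finset.sum_const,
      Finset.card_univ, smul_eq_mul] at this ⊢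
    omega
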